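/- Conventions. For a ring $A$, "module" means left module (not necessarily finitely generated). An exact complex $E$ of projective $A$-modules is *totally acyclic* if $\operatorname{Hom}_A(E,P)$ is exact for every projective $A$-module $P$; $\mathrm{GProj}(A)$ is the class of all modules isomorphic to a syzygy $\ker(E^i\to E^{i+1})$ of such a complex. Dually, $\mathrm{GInj}(A)$ is the class of all modules isomorphic to a syzygy of an exact complex $E$ of injective $A$-modules such that $\operatorname{Hom}_A(I,E)$ is exact for every injective $A$-module $I$. For a class $\mathcal X$ of $A$-modules, $\mathcal X^\perp=\{Y:\operatorname{Ext}^1_A(G,Y)=0\ \forall G\in\mathcal X\}$ and ${}^\perp\mathcal X=\{Y:\operatorname{Ext}^1_A(Y,G)=0\ \forall G\in\mathcal X\}$. An Artin algebra $A$ is *virtually Gorenstein* if $\mathrm{GProj}(A)^\perp={}^\perp\mathrm{GInj}(A)$. $\operatorname{Add}(M)$ is the class of direct summands of arbitrary direct sums of copies of $M$. Proposition 3.2. Let $k$ be a commutative artinian ring, let $R$ and $S$ be Artin $k$-algebras, and let ${}_SM_R$ be an $S$-$R$-bimodule on which $k$ acts centrally and which is finitely generated over $k$. Let $$\Gamma=\begin{pmatrix}R&0\\M&S\end{pmatrix}$$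 be the formal triangular matrix ring. Assume: (1) the functor $M\otimes_R-$ takes every acyclic complex of projective $R$-modules to an acyclic complex of $S$-modules; (2) $\operatorname{Add}({}_SM)\subseteq\mathrm{GProj}(S)^\perp$; (3) the functor $\operatorname{Hom}_S(M,-)$ takes every acyclic complex of injective $S$-modules to an acyclic complex of $R$-modules; (4) $\operatorname{Hom}_S(M,I)\in{}^\perp\mathrm{GInj}(R)$ for every injective $S$-module $I$. Then $\Gamma$ is virtually Gorenstein if and only if both $R$ and $S$ are virtually Gorenstein. -/

import Mathlib

open CategoryTheory

universe u v w

namespace TriGor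

open scoped TensorProduct

section TriangularMatrixRing

/-- The underlying type of the formal triangular matrix ring `Γ = (R 0; M S)` : the element
with entries `r`, `m`, `s` is the lower triangular matrix with diagonal `r, s` and lower left
entry `m`. -/
@[ext]
structure TriMatrix (R S M : Type u) : Type u where
  /-- upper left entry -/
  r : R
  /-- lower left entry -/
  m : M
  /-- lower right entry -/
  s : S

variable {R S M : Type u} [Ring R] [Ring S] [AddCommGroup M]

instance : Zero (TriMatrix R S M) := ⟨⟨0, 0, 0⟩⟩
instance : One (TriMatrix R S M) := ⟨⟨1, 0, 1⟩⟩
instance : Add (TriMatrix R S M) := ⟨fun a b => ⟨a.r + b.r, a.m + b.m, a.s + b.s⟩⟩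
instance : Neg (TriMatrix R S M) := ⟨fun a => ⟨-a.r, -a.m, -a.s⟩⟩

/-- Matrix multiplication `(r 0; m s) (r' 0; m' s') = (r r' 0; m r' + s m' s s')`. The right
action of `R` on the bimodule `M` is the action of `Rᵐᵒᵖ`. -/
instance [Module S M] [Module Rᵐᵒᵖ M] : Mul (TriMatrix R S M) :=
  ⟨fun a b => ⟨a.r * b.r, MulOpposite.op b.r • a.m + a.s • b.m, a.s * b.s⟩⟩

@[simp] theorem TriMatrix.zero_r : (0 : TriMatrix R S M).r = 0 := rfl
@[simp] theorem TriMatrix.zero_m : (0 : TriMatrix R S M).m = 0 := rfl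
@[simp] theorem TriMatrix.zero_s : (0 : TriMatrix R S M).s = 0 := rfl
@[simp] theorem TriMatrix.one_r : (1 : TriMatrix R S M).r = 1 := rfl
@[simp] theorem TriMatrix.one_m : (1 : TriMatrix R S M).m = 0 := rfl
@[simp] theorem TriMatrix.one_s : (1 : TriMatrix R S M).s = 1 := rfl
@[simp] theorem TriMatrix.add_r (a b : TriMatrix R S M) : (a + b).r = a.r + b.r := rfl
@[simp] theorem TriMatrix.add_m (a b : TriMatrix R S M) : (a + b).m = a.m + b.m := rfl
@[simp] theorem TriMatrix.add_s (a b : TriMatrix R S M) : (a + b).s = a.s + b.s := rfl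
@[simp] theorem TriMatrix.neg_r (a : TriMatrix R S M) : (-a).r = -a.r := rfl
@[simp] theorem TriMatrix.neg_m (a : TriMatrix R S M) : (-a).m = -a.m := rfl
@[simp] theorem TriMatrix.neg_s (a : TriMatrix R S M) : (-a).s = -a.s := rfl
@[simp] theorem TriMatrix.mul_r [Module S M] [Module Rᵐᵒᵖ M] (a b : TriMatrix R S M) :
    (a * b).r = a.r * b.r := rfl
@[simp] theorem TriMatrix.mul_m [Module S M] [Module Rᵐᵒᵖ M] (a b : TriMatrix R S M) :
    (a * b).m = MulOpposite.op b.r • a.m + a.s • b.m := rfl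
@[simp] theorem TriMatrix.mul_s [Module S M] [Module Rᵐᵒᵖ M] (a b : TriMatrix R S M) :
    (a * b).s = a.s * b.s := rfl

/-- The formal triangular matrix ring of an `S`-`R`-bimodule `M`. -/
instance [Module S M] [Module Rᵐᵒᵖ M] [SMulCommClass S Rᵐᵒᵖ M] : Ring (TriMatrix R S M) where
  add_assoc a b c := by ext <;> simp [add_assoc]
  zero_add a := by ext <;> simp
  add_zero a := by ext <;> simp
  add_comm a b := by ext <;> simp [add_comm]
  neg_add_cancel a := by ext <;> simp
  left_distrib a b c := by
    ext <;> simp [mul_add, add_smul, smul_add]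
    abel
  right_distrib a b c := by
    ext <;> simp [add_mul, add_smul, smul_add]
    abel
  zero_mul a := by ext <;> simp
  mul_zero a := by ext <;> simp
  one_mul a := by ext <;> simp
  mul_one a := by ext <;> simp
  mul_assoc a b c := by
    ext
    · simp [mul_assoc]
    · simp [mul_smul, smul_add, add_assoc, smul_comm]
    · simp [mul_assoc]
  nsmul := nsmulRec
  zsmul := zsmulRec

end TriangularMatrixRing

section Tensor

variable (R S M : Type u) [Ring R] [Ring S] [AddCommGroup M] [Module S M] [Module Rᵐᵒᵖ M]

/-- The relations `m r ⊗ x = m ⊗ r x` inside `M ⊗_ℤ X`. For an `S`-`R`-bimodule `M` the set of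
generators is stable under `S`, so that its `S`-span is the additive subgroup it generates. -/
def balancedRel (X : Type u) [AddCommGroup X] [Module R X] : Submodule S (M ⊗[ℤ] X) :=
  Submodule.span S {t | ∃ (m : M) (r : R) (x : X),
    t = (MulOpposite.op r • m) ⊗ₜ[ℤ] x - m ⊗ₜ[ℤ] (r • x)}

/-- The left `S`-module `M ⊗_R X`, for an `S`-`R`-bimodule `M` and a left `R`-module `X` over a
not necessarily commutative ring `R`. -/
abbrev BimodTensor (X : Type u) [AddCommGroup X] [Module R X] : Type u :=
  (M ⊗[ℤ] X) ⧸ balancedRel R S M X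

variable {R}

/-- The `S`-linear map `M ⊗_ℤ X → M ⊗_ℤ X'`, `m ⊗ x ↦ m ⊗ f x`. -/
def preTensorMap {X X' : Type u} [AddCommGroup X] [Module R X] [AddCommGroup X'] [Module R X']
    (f : X →ₗ[R] X') : (M ⊗[ℤ] X) →ₗ[S] (M ⊗[ℤ] X') :=
  TensorProduct.AlgebraTensorModule.map (LinearMap.id : M →ₗ[S] M) f.toAddMonoidHom.toIntLinearMap

theorem balancedRel_le_comap {X X' : Type u} [AddCommGroup X] [Module R X] [AddCommGroup X']
    [Module R X'] (f : X →ₗ[R] X') :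
    balancedRel R S M X ≤ (balancedRel R S M X').comap (preTensorMap S M f) := by
  refine Submodule.span_le.2 ?_
  rintro _ ⟨m, r, x, rfl⟩
  refine Submodule.subset_span ⟨m, r, f x, ?_⟩
  simp [preTensorMap]

/-- The `S`-linear map `M ⊗_R f`. -/
def tensorMap {X X' : Type u} [AddCommGroup X] [Module R X] [AddCommGroup X'] [Module R X']
    (f : X →ₗ[R] X') : BimodTensor R S M X →ₗ[S] BimodTensor R S M X' :=
  Submodule.mapQ _ _ (preTensorMap S M f) (balancedRel_le_comap S M f)

@[simp] theorem tensorMap_mk {X X' : Type u} [AddCommGroup X] [Module R X] [AddCommGroup X']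
    [Module R X'] (f : X →ₗ[R] X') (m : M) (x : X) :
    tensorMap S M f (Submodule.Quotient.mk (m ⊗ₜ[ℤ] x)) =
      Submodule.Quotient.mk (m ⊗ₜ[ℤ] f x) := rfl

theorem bimodTensor_hom_ext {X Y : Type u} [AddCommGroup X] [Module R X] [AddCommGroup Y]
    [Module S Y] {f g : BimodTensor R S M X →ₗ[S] Y}
    (h : ∀ (m : M) (x : X), f (Submodule.Quotient.mk (m ⊗ₜ[ℤ] x)) =
      g (Submodule.Quotient.mk (m ⊗ₜ[ℤ] x))) : f = g := by
  refine Submodule.linearMap_qext _ (TensorProduct.AlgebraTensorModule.ext fun m x => h m x)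

variable (R)

/-- The functor `M ⊗_R - : Mod R ⥤ Mod S`. -/
noncomputable def tensorFunctor : ModuleCat.{u} R ⥤ ModuleCat.{u} S where
  obj X := ModuleCat.of S (BimodTensor R S M X)
  map f := ModuleCat.ofHom (tensorMap S M f.hom)
  map_id X := by
    ext1
    exact bimodTensor_hom_ext S M fun m x => by simp
  map_comp f g := by
    ext1
    exact bimodTensor_hom_ext S M fun m x => by simp

instance : (tensorFunctor R S M).Additive where
  map_add {X Y f g} := by
    ext1
    refine bimodTensor_hom_ext S M fun m x => ?_
    change (balancedRel R S M Y).mkQ (m ⊗ₜ[ℤ] (f.hom x + g.hom x)) =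
      (balancedRel R S M Y).mkQ (m ⊗ₜ[ℤ] f.hom x) + (balancedRel R S M Y).mkQ (m ⊗ₜ[ℤ] g.hom x)
    rw [TensorProduct.tmul_add, map_add]

end Tensor

section Hom

variable (R S M : Type u) [Ring R] [Ring S] [AddCommGroup M] [Module S M] [Module Rᵐᵒᵖ M]

/-- The group `Hom_S(M, Y)`; the ring `R` is recorded because of the `R`-action below. -/
def BimodHom (_R S M : Type u) [Ring S] [AddCommGroup M] [Module S M]
    (Y : Type u) [AddCommGroup Y] [Module S Y] : Type u := M →ₗ[S] Y

instance (Y : Type u) [AddCommGroup Y] [Module S Y] : AddCommGroup (BimodHom R S M Y) :=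
  inferInstanceAs (AddCommGroup (M →ₗ[S] Y))

variable [SMulCommClass S Rᵐᵒᵖ M]

/-- The left `R`-module structure on `Hom_S(M, Y)` : `(r f)(m) = f (m r)`. -/
instance (Y : Type u) [AddCommGroup Y] [Module S Y] : Module R (BimodHom R S M Y) where
  smul r f :=
    { toFun := fun m => (show M →ₗ[S] Y from f) (MulOpposite.op r • m)
      map_add' := fun m m' => by rw [smul_add, map_add]
      map_smul' := fun s m => by rw [← smul_comm, map_smul, RingHom.id_apply] }
  one_smul f := LinearMap.ext fun m => congrArg (show M →ₗ[S] Y from f) (one_smul Rᵐᵒᵖ m)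
  mul_smul r r' f := LinearMap.ext fun m =>
    congrArg (show M →ₗ[S] Y from f) (mul_smul (MulOpposite.op r') (MulOpposite.op r) m)
  smul_zero _ := rfl
  smul_add _ _ _ := rfl
  add_smul r r' f := LinearMap.ext fun m =>
    (congrArg (show M →ₗ[S] Y from f) (add_smul (MulOpposite.op r) (MulOpposite.op r') m)).trans
      (map_add (show M →ₗ[S] Y from f) _ _)
  zero_smul f := LinearMap.ext fun m =>
    (congrArg (show M →ₗ[S] Y from f) (zero_smul Rᵐᵒᵖ m)).trans
      (map_zero (show M →ₗ[S] Y from f))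

/-- Postcomposition `Hom_S(M, g) : Hom_S(M, Y) → Hom_S(M, Y')`, an `R`-linear map. -/
def homMap {Y Y' : Type u} [AddCommGroup Y] [Module S Y] [AddCommGroup Y'] [Module S Y']
    (g : Y →ₗ[S] Y') : BimodHom R S M Y →ₗ[R] BimodHom R S M Y' where
  toFun f := g.comp (show M →ₗ[S] Y from f)
  map_add' f f' := LinearMap.comp_add (show M →ₗ[S] Y from f) (show M →ₗ[S] Y from f') g
  map_smul' _ _ := rfl

/-- The functor `Hom_S(M, -) : Mod S ⥤ Mod R`. -/
def homFunctor : ModuleCat.{u} S ⥤ ModuleCat.{u} R where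
  obj Y := ModuleCat.of R (BimodHom R S M Y)
  map g := ModuleCat.ofHom (homMap R S M g.hom)
  map_id _ := rfl
  map_comp _ _ := rfl

instance : (homFunctor R S M).Additive where
  map_add := rfl

end Hom

section Gorenstein

variable {C : Type v} [Category.{w} C] [Abelian C]

/-- A totally acyclic complex of projectives: an exact complex `E` of projective objects such that
`Hom(E, P)` is exact for every projective `P`. -/
structure IsTotallyAcyclicProj (E : CochainComplex C ℤ) : Prop where
  projective : ∀ i, Projective (E.X i)
  acyclic : E.Acyclic
  hom_exact : ∀ (P : C), Projective P → ∀ i : ℤ,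
    Function.Exact (fun g : E.X (i + 1) ⟶ P => E.d i (i + 1) ≫ g)
      (fun f : E.X i ⟶ P => E.d (i - 1) i ≫ f)

/-- A totally acyclic complex of injectives: an exact complex `E` of injective objects such that
`Hom(I, E)` is exact for every injective `I`. -/
structure IsTotallyAcyclicInj (E : CochainComplex C ℤ) : Prop where
  injective : ∀ i, Injective (E.X i)
  acyclic : E.Acyclic
  hom_exact : ∀ (I : C), Injective I → ∀ i : ℤ,
    Function.Exact (fun g : I ⟶ E.X (i - 1) => g ≫ E.d (i - 1) i)
      (fun f : I ⟶ E.X i => f ≫ E.d i (i + 1))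

variable (C) in
/-- The Gorenstein projective objects: the syzygies of totally acyclic complexes of projectives. -/
def GProj : ObjectProperty C := fun X =>
  ∃ (E : CochainComplex C ℤ) (i : ℤ), IsTotallyAcyclicProj E ∧ Nonempty (X ≅ E.cycles i)

variable (C) in
/-- The Gorenstein injective objects: the syzygies of totally acyclic complexes of injectives. -/
def GInj : ObjectProperty C := fun X =>
  ∃ (E : CochainComplex C ℤ) (i : ℤ), IsTotallyAcyclicInj E ∧ Nonempty (X ≅ E.cycles i)

end Gorenstein

section Orthogonal

variable {Λ : Type u} [Ring Λ]

/-- `𝒳^⊥`: the modules `Y` with `Ext¹(G, Y) = 0` for all `G` in `𝒳`. -/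
def extRightPerp (𝒳 : ObjectProperty (ModuleCat.{u} Λ)) : ObjectProperty (ModuleCat.{u} Λ) :=
  fun Y => ∀ G, 𝒳 G → Subsingleton (Abelian.Ext G Y 1)

/-- `^⊥𝒳`: the modules `Y` with `Ext¹(Y, G) = 0` for all `G` in `𝒳`. -/
def extLeftPerp (𝒳 : ObjectProperty (ModuleCat.{u} Λ)) : ObjectProperty (ModuleCat.{u} Λ) :=
  fun Y => ∀ G, 𝒳 G → Subsingleton (Abelian.Ext Y G 1)

/-- `Add(M)`: the direct summands of arbitrary direct sums of copies of `M`. -/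
def addClosure (Λ : Type u) [Ring Λ] (M : Type u) [AddCommGroup M] [Module Λ M] :
    ObjectProperty (ModuleCat.{u} Λ) :=
  fun Y => ∃ ι : Type u, Nonempty (Retract Y (ModuleCat.of Λ (DirectSum ι fun _ => M)))

/-- `Λ` is virtually Gorenstein: `GProj(Λ)^⊥ = ^⊥GInj(Λ)`. -/
def VirtuallyGorenstein (Λ : Type u) [Ring Λ] : Prop :=
  extRightPerp (GProj (ModuleCat.{u} Λ)) = extLeftPerp (GInj (ModuleCat.{u} Λ))

end Orthogonal

end TriGor

/-!
A module over `Γ = (R 0; M S)` is a triple `(X, Y, M ⊗_R X ⟶ Y)`. The theorem holds because both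
classes in the definition of virtual Gorensteinness are computed componentwise: `N = (X, Y)` lies
in `GProj(Γ)^⊥` iff `X ∈ GProj(R)^⊥` and `Y ∈ GProj(S)^⊥`, and likewise for `^⊥GInj(Γ)`. Testing on
the modules `(X, 0)` and `(0, Y)` then gives both directions.

Since syzygies of totally acyclic complexes are the Gorenstein projectives, `N ∈ GProj^⊥` means
that `Hom(E, N)` is exact for every totally acyclic `E` (`extRightPerp_GProj_iff`), so that only
complexes are needed and no derived functor has to be compared across rings. A complex `E` of
projective `Γ`-modules has a degreewise split subcomplex `(X, M ⊗ X)`, where `X` is its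
`R`-component, and the quotient is `(0, c E)` for a complex `c E` of projective `S`-modules.
By the conditions on `M ⊗_R -` and `Add(M)`, the complexes `X` and `c E` are again totally acyclic
if `E` is, and conversely, `(X, M ⊗ X)` and `(0, Y)` are totally acyclic over `Γ` if `X` and `Y`
are so over `R` and `S`. Comparing `Hom(E, N)` with `Hom(X, e_R N)` and `Hom(c E, e_S N)` gives
`Gluing.Compatible.totallyAcyclicPerp_iff`.

The statement on Gorenstein injectives is dual. To avoid a second proof, the argument is carried
out for a `Gluing`, a self-dual axiomatization of the functors between modules over `R`, `S` and
`Γ`, and for complexes of arbitrary shape: the injective case is the projective case in the opposite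
categories, where `R` and `S` change places and `Hom_S(M, -)` takes the role of `M ⊗_R -`.
-/

/-! ### Exactness of Hom complexes -/

namespace TriGor

section HomExact

open Limits

variable {C : Type*} [Category* C] [Abelian C] {D : Type*} [Category* D] [Abelian D]
  {ι : Type*} {c : ComplexShape ι}

/-- The complex `Hom(E, N)` is exact, in all degrees that have a predecessor and a successor. -/
def HomExact (E : HomologicalComplex C c) (N : C) : Prop :=
  ∀ ⦃i j k : ι⦄, c.Rel i j → c.Rel j k → ∀ f : E.X j ⟶ N, E.d i j ≫ f = 0 →
    ∃ g : E.X k ⟶ N, E.d j k ≫ g = f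

/-- Total acyclicity for complexes of projectives of any shape. Leaving the shape free makes the
notion applicable in the opposite category, where a cochain complex becomes a complex of shape
`(ComplexShape.up ℤ).symm`. -/
structure TotallyAcyclic (E : HomologicalComplex C c) : Prop where
  projective : ∀ i, Projective (E.X i)
  acyclic : E.Acyclic
  homExact : ∀ P : C, Projective P → HomExact E P

variable (C c) in
/-- The objects `N` such that `Hom(E, N)` is exact for all totally acyclic complexes `E` of
projectives. -/
def totallyAcyclicPerp : ObjectProperty C := fun N =>
  ∀ E : HomologicalComplex C c, TotallyAcyclic E → HomExact E N

theorem HomExact.of_iso {E : HomologicalComplex C c} {N N' : C} (h : HomExact E N) (e : N ≅ N') :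
    HomExact E N' := by
  intro i j k hij hjk f hf
  obtain ⟨g, hg⟩ := h hij hjk (f ≫ e.inv) (by rw [reassoc_of% hf, zero_comp])
  exact ⟨g ≫ e.hom, by rw [reassoc_of% hg]; simp⟩

theorem totallyAcyclicPerp_congr {N N' : C} (e : N ≅ N') :
    totallyAcyclicPerp C c N ↔ totallyAcyclicPerp C c N' :=
  ⟨fun h E hE => (h E hE).of_iso e, fun h E hE => (h E hE).of_iso e.symm⟩

theorem totallyAcyclicPerp_of_isZero {N : C} (hN : IsZero N) : totallyAcyclicPerp C c N :=
  fun _ _ _ _ _ _ _ _ _ => ⟨0, hN.eq_of_tgt _ _⟩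

theorem HomExact.of_shortExact_X₂ {E : HomologicalComplex C c} (hE : ∀ i, Projective (E.X i))
    {T : ShortComplex C} (hT : T.ShortExact) (h₁ : HomExact E T.X₁) (h₃ : HomExact E T.X₃) :
    HomExact E T.X₂ := by
  intro i j k hij hjk f hf
  have := hT.mono_f
  have := hT.epi_g
  obtain ⟨g, hg⟩ := h₃ hij hjk (f ≫ T.g) (by rw [reassoc_of% hf, zero_comp])
  have := hE k
  let g' := Projective.factorThru g T.g
  have hg' : g' ≫ T.g = g := Projective.factorThru_comp _ _
  have h0 : (f - E.d j k ≫ g') ≫ T.g = 0 := by simp [hg', hg]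
  obtain ⟨h, hh⟩ := h₁ hij hjk (hT.exact.lift _ h0) (by
    rw [← cancel_mono T.f, Category.assoc, hT.exact.lift_f]
    simp [hf])
  refine ⟨g' + h ≫ T.f, ?_⟩
  rw [Preadditive.comp_add, reassoc_of% hh, hT.exact.lift_f]
  abel

/-- A cocycle with values in the quotient need not lift to a cocycle; the failure is a cocycle one
degree lower, which is why every degree must have a predecessor. -/
theorem HomExact.of_shortExact_X₃ (hc : ∀ j, ∃ i, c.Rel i j) {E : HomologicalComplex C c}
    (hE : ∀ i, Projective (E.X i)) {T : ShortComplex C} (hT : T.ShortExact)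
    (h₁ : HomExact E T.X₁) (h₂ : HomExact E T.X₂) : HomExact E T.X₃ := by
  intro i j k hij hjk f hf
  have := hT.mono_f
  have := hT.epi_g
  have := hE j
  let f' := Projective.factorThru f T.g
  have hf' : f' ≫ T.g = f := Projective.factorThru_comp _ _
  have h0 : (E.d i j ≫ f') ≫ T.g = 0 := by simp [hf', hf]
  obtain ⟨i', hi'⟩ := hc i
  obtain ⟨h, hh⟩ := h₁ hi' hij (hT.exact.lift _ h0) (by
    rw [← cancel_mono T.f, Category.assoc, hT.exact.lift_f]
    simp)
  obtain ⟨g, hg⟩ := h₂ hij hjk (f' - h ≫ T.f) (by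
    rw [Preadditive.comp_sub, reassoc_of% hh, hT.exact.lift_f, sub_self])
  refine ⟨g ≫ T.g, ?_⟩
  rw [reassoc_of% hg]
  simp [hf']

variable {L : C ⥤ D} {R : D ⥤ C}

theorem homExact_map_iff (adj : L ⊣ R) [L.Additive] (E : HomologicalComplex C c) (N : D) :
    HomExact ((L.mapHomologicalComplex c).obj E) N ↔ HomExact E (R.obj N) := by
  have := adj.right_adjoint_additive
  have key : HomExact ((L.mapHomologicalComplex c).obj E) N ↔
      ∀ ⦃i j k : ι⦄, c.Rel i j → c.Rel j k → ∀ f : L.obj (E.X j) ⟶ N, L.map (E.d i j) ≫ f = 0 →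
        ∃ g : L.obj (E.X k) ⟶ N, L.map (E.d j k) ≫ g = f := Iff.rfl
  rw [key]
  constructor
  · intro h i j k hij hjk f hf
    obtain ⟨g, hg⟩ := h hij hjk ((adj.homEquiv _ _).symm f) (by
      rw [← adj.homEquiv_naturality_left_symm, hf, adj.homEquiv_counit, L.map_zero, zero_comp])
    refine ⟨adj.homEquiv _ _ g, ?_⟩
    rw [← adj.homEquiv_naturality_left, hg, Equiv.apply_symm_apply]
  · intro h i j k hij hjk f hf
    obtain ⟨g, hg⟩ := h hij hjk (adj.homEquiv _ _ f) (by
      rw [← adj.homEquiv_naturality_left, hf, adj.homEquiv_apply, R.map_zero, comp_zero])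
    refine ⟨(adj.homEquiv _ _).symm g, ?_⟩
    rw [← adj.homEquiv_naturality_left_symm, hg, Equiv.symm_apply_apply]

/-- A left adjoint `L` preserves total acyclicity of `E` if `L E` is acyclic and the right adjoint
maps projectives into `totallyAcyclicPerp`, because `Hom(L E, P)` is `Hom(E, R P)`. -/
theorem TotallyAcyclic.map (adj : L ⊣ R) [L.Additive] [R.PreservesEpimorphisms]
    {E : HomologicalComplex C c} (hE : TotallyAcyclic E)
    (hL : ((L.mapHomologicalComplex c).obj E).Acyclic)
    (hR : ∀ P, Projective P → totallyAcyclicPerp C c (R.obj P)) :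
    TotallyAcyclic ((L.mapHomologicalComplex c).obj E) where
  projective i := adj.map_projective _ (hE.projective i)
  acyclic := hL
  homExact P hP := (homExact_map_iff adj E P).2 (hR P hP E hE)

theorem acyclic_map (F : C ⥤ D) [F.Additive] [PreservesFiniteLimits F] [PreservesFiniteColimits F]
    {E : HomologicalComplex C c} (h : E.Acyclic) :
    ((F.mapHomologicalComplex c).obj E).Acyclic := fun i =>
  ShortComplex.Exact.map (h i) F

end HomExact

/-! ### Gluings of abelian categories -/

/-- A category `G` glued from `A` and `B`, like the modules over a triangular matrix ring: exact
projections `pA : G ⥤ A` and `pB : G ⥤ B` that jointly detect zero objects, with left adjoints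
`lA`, `lB` and right adjoints `rA`, `rB`. For modules `(X, Y, M ⊗ X ⟶ Y)`, the functors are
`lA X = (X, M ⊗ X)`, `rA X = (X, 0)`, `lB Y = (0, Y)`, `rB Y = (Hom(M, Y), Y)`. The notion is
self-dual, see `Gluing.op`. -/
structure Gluing (A B G : Type*) [Category* A] [Category* B] [Category* G]
    [Abelian A] [Abelian B] [Abelian G] where
  /-- the projection to `A` -/
  pA : G ⥤ A
  /-- the left adjoint of `pA` -/
  lA : A ⥤ G
  /-- the right adjoint of `pA` -/
  rA : A ⥤ G
  /-- the projection to `B` -/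
  pB : G ⥤ B
  /-- the left adjoint of `pB` -/
  lB : B ⥤ G
  /-- the right adjoint of `pB` -/
  rB : B ⥤ G
  /-- the adjunctions `lA ⊣ pA ⊣ rA` -/
  tA : Adjunction.Triple lA pA rA
  /-- the adjunctions `lB ⊣ pB ⊣ rB` -/
  tB : Adjunction.Triple lB pB rB
  /-- `rA` is fully faithful -/
  ffA : rA.FullyFaithful
  /-- `lB` is fully faithful -/
  ffB : lB.FullyFaithful
  pA_lB : ∀ Y, Limits.IsZero (pA.obj (lB.obj Y))
  pB_rA : ∀ X, Limits.IsZero (pB.obj (rA.obj X))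
  isZero : ∀ N, Limits.IsZero (pA.obj N) → Limits.IsZero (pB.obj N) → Limits.IsZero N

namespace Gluing

open Limits

variable {A B G : Type*} [Category* A] [Category* B] [Category* G]
    [Abelian A] [Abelian B] [Abelian G]

/-- Duality exchanges the roles of `A` and `B`, and of left and right adjoints. -/
noncomputable def op (T : Gluing A B G) : Gluing Bᵒᵖ Aᵒᵖ Gᵒᵖ where
  pA := T.pB.op
  lA := T.rB.op
  rA := T.lB.op
  pB := T.pA.op
  lB := T.rA.op
  rB := T.lA.op
  tA := T.tB.op
  tB := T.tA.op
  ffA := T.ffB.op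
  ffB := T.ffA.op
  pA_lB Y := (T.pB_rA Y.unop).op
  pB_rA X := (T.pA_lB X.unop).op
  isZero N hA hB := (T.isZero N.unop hB.unop hA.unop).op

variable (T : Gluing A B G)

instance : T.pA.IsRightAdjoint := T.tA.adj₁.isRightAdjoint
instance : T.pA.IsLeftAdjoint := T.tA.adj₂.isLeftAdjoint
instance : T.pB.IsRightAdjoint := T.tB.adj₁.isRightAdjoint
instance : T.pB.IsLeftAdjoint := T.tB.adj₂.isLeftAdjoint
instance : T.pA.Additive := Functor.additive_of_preserves_binary_products _
instance : T.pB.Additive := Functor.additive_of_preserves_binary_products _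
instance : T.lA.Additive := T.tA.adj₁.left_adjoint_additive
instance : T.rA.Additive := T.tA.adj₂.right_adjoint_additive
instance : T.lB.Additive := T.tB.adj₁.left_adjoint_additive
instance : T.rB.Additive := T.tB.adj₂.right_adjoint_additive
instance : T.lA.Full := (T.tA.fullyFaithfulEquiv.symm T.ffA).full
instance : T.lA.Faithful := (T.tA.fullyFaithfulEquiv.symm T.ffA).faithful
instance : T.rA.Full := T.ffA.full
instance : T.rA.Faithful := T.ffA.faithful
instance : T.lB.Full := T.ffB.full
instance : T.lB.Faithful := T.ffB.faithful

theorem exact_of {S : ShortComplex G} (hA : (S.map T.pA).Exact) (hB : (S.map T.pB).Exact) :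
    S.Exact := by
  rw [ShortComplex.exact_iff_isZero_homology] at *
  exact T.isZero _ (hA.of_iso (S.mapHomologyIso T.pA).symm)
    (hB.of_iso (S.mapHomologyIso T.pB).symm)

theorem epi_of {N N' : G} (f : N ⟶ N') (hA : Epi (T.pA.map f)) (hB : Epi (T.pB.map f)) :
    Epi f := by
  refine Preadditive.epi_of_isZero_cokernel f (T.isZero _ ?_ ?_)
  · exact (isZero_cokernel_of_epi (T.pA.map f)).of_iso (PreservesCokernel.iso T.pA f)
  · exact (isZero_cokernel_of_epi (T.pB.map f)).of_iso (PreservesCokernel.iso T.pB f)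

theorem mono_of {N N' : G} (f : N ⟶ N') (hA : Mono (T.pA.map f)) (hB : Mono (T.pB.map f)) :
    Mono f := by
  refine Preadditive.mono_of_isZero_kernel f (T.isZero _ ?_ ?_)
  · exact (isZero_kernel_of_mono (T.pA.map f)).of_iso (PreservesKernel.iso T.pA f)
  · exact (isZero_kernel_of_mono (T.pB.map f)).of_iso (PreservesKernel.iso T.pB f)

theorem isIso_of {N N' : G} (f : N ⟶ N') (hA : IsIso (T.pA.map f)) (hB : IsIso (T.pB.map f)) :
    IsIso f := by
  have := T.mono_of f inferInstance inferInstance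
  have := T.epi_of f inferInstance inferInstance
  exact isIso_of_mono_of_epi f

instance : T.rA.PreservesEpimorphisms where
  preserves f hf := by
    refine T.epi_of _ ?_ ((T.pB_rA _).epi _)
    have e := T.tA.adj₂.counit.naturality f
    have : Epi (T.pA.map (T.rA.map f) ≫ T.tA.adj₂.counit.app _) := by
      dsimp at e
      rw [e]
      infer_instance
    exact (epi_comp_iff_of_isIso _ (T.tA.adj₂.counit.app _)).1 this

instance : T.lB.PreservesEpimorphisms :=
  Functor.preservesEpimorphisms_of_adjunction T.tB.adj₁

theorem isIso_counit_of_isZero {K : G} (hK : IsZero (T.pA.obj K)) :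
    IsIso (T.tB.adj₁.counit.app K) := by
  refine T.isIso_of _ ?_ inferInstance
  exact isIso_of_source_target_iso_zero _ (T.pA_lB _).isoZero hK.isoZero

theorem isZero_pA_cokernel (N : G) : IsZero (T.pA.obj (cokernel (T.tA.adj₁.counit.app N))) :=
  (isZero_cokernel_of_epi (T.pA.map (T.tA.adj₁.counit.app N))).of_iso (PreservesCokernel.iso T.pA _)

theorem lA_lB_hom_eq_zero {X : A} {Y : B} (f : T.lA.obj X ⟶ T.lB.obj Y) : f = 0 :=
  (T.tA.adj₁.homEquiv _ _).injective ((T.pA_lB Y).eq_of_tgt _ _)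

/-- The cokernel of `lA (pA N) ⟶ N` comes from `B`. -/
noncomputable def cokernelIso (N : G) :
    T.lB.obj (T.pB.obj (cokernel (T.tA.adj₁.counit.app N))) ≅
      cokernel (T.tA.adj₁.counit.app N) :=
  have := T.isIso_counit_of_isZero (T.isZero_pA_cokernel N)
  asIso (T.tB.adj₁.counit.app _)

/-- Maps `c N ⟶ Y` correspond to maps `N ⟶ lB Y`, where `c N` is the `B`-part of the cokernel of
`lA (pA N) ⟶ N`. -/
noncomputable def cokerHomEquiv (N : G) (Y : B) :
    (T.pB.obj (cokernel (T.tA.adj₁.counit.app N)) ⟶ Y) ≃ (N ⟶ T.lB.obj Y) :=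
  T.ffB.homEquiv.trans
    { toFun f := cokernel.π (T.tA.adj₁.counit.app N) ≫ (T.cokernelIso N).inv ≫ f
      invFun f := (T.cokernelIso N).hom ≫
        cokernel.desc (T.tA.adj₁.counit.app N) f (T.lA_lB_hom_eq_zero _)
      left_inv f := by
        rw [← Iso.eq_inv_comp (T.cokernelIso N), ← cancel_epi (cokernel.π _), cokernel.π_desc]
      right_inv f := by
        dsimp only
        rw [Iso.inv_hom_id_assoc, cokernel.π_desc] }

/-- The left adjoint `c` of `lB`. For modules `(X, Y, M ⊗ X ⟶ Y)` it is the cokernel of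
`M ⊗ X ⟶ Y`. -/
noncomputable def coker : G ⥤ B :=
  Adjunction.leftAdjointOfEquiv T.cokerHomEquiv fun N Y Y' g h => by
    simp [cokerHomEquiv, Functor.FullyFaithful.homEquiv]

/-- The adjunction `c ⊣ lB`. -/
noncomputable def cokerAdj : T.coker ⊣ T.lB := Adjunction.adjunctionOfEquivLeft _ _

instance : T.coker.Additive := T.cokerAdj.left_adjoint_additive

theorem cokerAdj_unit_app (N : G) : T.cokerAdj.unit.app N =
    cokernel.π (T.tA.adj₁.counit.app N) ≫ (T.cokernelIso N).inv := by
  have : T.cokerAdj.unit.app N = T.cokerHomEquiv N _ (𝟙 _) := by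
    simp [cokerAdj]
    rfl
  rw [this]
  simp [cokerHomEquiv, Functor.FullyFaithful.homEquiv]
  rfl

/-- The sequence `lA (pA N) ⟶ N ⟶ lB (c N)`. It is always right exact, and short exact for
projective `N`. -/
noncomputable def seq (N : G) : ShortComplex G :=
  ShortComplex.mk (T.tA.adj₁.counit.app N) (T.cokerAdj.unit.app N) (T.lA_lB_hom_eq_zero _)

/-- For modules: the structure map `M ⊗ X ⟶ Y` of a projective module `(X, Y)` is injective. -/
theorem mono_counit (P : G) [Projective P] : Mono (T.tA.adj₁.counit.app P) := by
  -- `P` is a direct summand of `lA (pA P) ⊞ lB (pB P)`, where the claim is clear.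
  let W := T.lA.obj (T.pA.obj P) ⊞ T.lB.obj (T.pB.obj P)
  let i : T.lA.obj (T.pA.obj P) ⟶ W := biprod.inl
  let φ : W ⟶ P := biprod.desc (T.tA.adj₁.counit.app P) (T.tB.adj₁.counit.app P)
  have hφ : Epi φ := by
    refine T.epi_of _ ?_ ?_
    · refine epi_of_epi_fac (f := T.pA.map i) (h := T.pA.map (T.tA.adj₁.counit.app P)) ?_
      rw [← T.pA.map_comp, biprod.inl_desc]
    · refine epi_of_epi_fac (f := T.pB.map (biprod.inr : _ ⟶ W))
        (h := T.pB.map (T.tB.adj₁.counit.app P)) ?_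
      rw [← T.pB.map_comp, biprod.inr_desc]
  have hi : IsIso (T.pA.map i) := by
    refine ⟨T.pA.map biprod.fst, ?_, ?_⟩
    · rw [← T.pA.map_comp, biprod.inl_fst, T.pA.map_id]
    · have h0 : T.pA.map (biprod.snd : W ⟶ _) = 0 := (T.pA_lB _).eq_of_tgt _ _
      have h1 := congrArg T.pA.map (biprod.total : _ = 𝟙 W)
      rw [T.pA.map_add, T.pA.map_comp, T.pA.map_comp, h0, zero_comp, add_zero, T.pA.map_id] at h1
      exact h1
  have hW : Mono (T.tA.adj₁.counit.app W) := by
    have h := T.tA.adj₁.counit.naturality i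
    have : Mono (T.lA.map (T.pA.map i) ≫ T.tA.adj₁.counit.app W) := by
      dsimp at h
      rw [h]
      infer_instance
    exact (mono_comp_iff_of_isIso (T.lA.map (T.pA.map i)) _).1 this
  let s : P ⟶ W := Projective.factorThru (𝟙 P) φ
  have hs : s ≫ φ = 𝟙 P := Projective.factorThru_comp _ _
  have : Mono (T.lA.map (T.pA.map s)) := by
    have : IsSplitMono (T.lA.map (T.pA.map s)) :=
      ⟨⟨T.lA.map (T.pA.map φ), by rw [← T.lA.map_comp, ← T.pA.map_comp, hs]; simp⟩⟩
    infer_instance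
  have h := T.tA.adj₁.counit.naturality s
  dsimp at h
  exact mono_of_mono_fac h.symm

theorem seq_shortExact (P : G) [Projective P] : (T.seq P).ShortExact where
  exact := by
    refine ShortComplex.exact_of_iso ?_ (ShortComplex.exact_cokernel (T.tA.adj₁.counit.app P))
    exact ShortComplex.isoMk (Iso.refl _) (Iso.refl _) (T.cokernelIso P).symm (by simp [seq])
      (by
        simp only [seq, Functor.id_obj, Iso.refl_hom, cokerAdj_unit_app]
        exact Category.id_comp _)
  mono_f := T.mono_counit P
  epi_g := by
    dsimp [seq]
    rw [cokerAdj_unit_app]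
    have h : Epi (cokernel.π (T.tA.adj₁.counit.app P) ≫ (T.cokernelIso P).inv) := epi_comp _ _
    exact h

/-! ### Totally acyclic complexes in a gluing -/

variable {ι : Type*} {c : ComplexShape ι}

theorem acyclic_of {E : HomologicalComplex G c}
    (hA : ((T.pA.mapHomologicalComplex c).obj E).Acyclic)
    (hB : ((T.pB.mapHomologicalComplex c).obj E).Acyclic) : E.Acyclic := fun i =>
  T.exact_of (hA i) (hB i)

theorem acyclic_lB {E : HomologicalComplex B c} (hE : E.Acyclic) :
    ((T.lB.mapHomologicalComplex c).obj E).Acyclic := by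
  refine T.acyclic_of (fun i => ?_) fun i => ?_
  · exact ShortComplex.exact_of_isZero_X₂ _ (T.pA_lB _)
  · exact (hE i).of_iso
      ((NatIso.mapHomologicalComplex (asIso T.tB.adj₁.unit) c).app E)

theorem acyclic_lA {E : HomologicalComplex A c} (hE : E.Acyclic)
    (hE' : (((T.lA ⋙ T.pB).mapHomologicalComplex c).obj E).Acyclic) :
    ((T.lA.mapHomologicalComplex c).obj E).Acyclic := by
  refine T.acyclic_of (fun i => ?_) hE'
  exact (hE i).of_iso ((NatIso.mapHomologicalComplex (asIso T.tA.adj₁.unit) c).app E)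

/-- The conditions on a gluing under which total acyclicity passes between `G` and the components
`A` and `B`. For modules over a triangular matrix ring `lA ⋙ pB` is `M ⊗ -`; in the dual gluing
`lA ⋙ pB` is replaced by `rB ⋙ pA`, which is `Hom(M, -)`. -/
structure Compatible (c : ComplexShape ι) : Prop where
  acyclic : ∀ E : HomologicalComplex A c, (∀ i, Projective (E.X i)) → E.Acyclic →
    (((T.lA ⋙ T.pB).mapHomologicalComplex c).obj E).Acyclic
  perp : ∀ P, Projective P → totallyAcyclicPerp B c (T.pB.obj (T.lA.obj P))

variable {T}

theorem projective_pA {P : G} (hP : Projective P) : Projective (T.pA.obj P) :=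
  T.tA.adj₂.map_projective _ hP

theorem projective_coker {P : G} (hP : Projective P) : Projective (T.coker.obj P) :=
  T.cokerAdj.map_projective _ hP

theorem projective_lB {P : B} (hP : Projective P) : Projective (T.lB.obj P) :=
  T.tB.adj₁.map_projective _ hP

theorem projective_lA {P : A} (hP : Projective P) : Projective (T.lA.obj P) :=
  T.tA.adj₁.map_projective _ hP

/-- The `B`-part of a projective `P` is an extension of the projective `c P` by
`pB (lA (pA P))`. -/
theorem Compatible.perp_pB (h : T.Compatible c) {P : G} (hP : Projective P) :
    totallyAcyclicPerp B c (T.pB.obj P) := by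
  intro E hE
  refine HomExact.of_shortExact_X₂ hE.projective ((T.seq_shortExact P).map_of_exact T.pB) ?_ ?_
  · exact h.perp _ (projective_pA hP) E hE
  · refine hE.homExact _ (Projective.of_iso ((asIso T.tB.adj₁.unit).app _) (projective_coker hP))

theorem Compatible.totallyAcyclic_lA (h : T.Compatible c) {E : HomologicalComplex A c}
    (hE : TotallyAcyclic E) : TotallyAcyclic ((T.lA.mapHomologicalComplex c).obj E) :=
  hE.map T.tA.adj₁ (T.acyclic_lA hE.acyclic (h.acyclic E hE.projective hE.acyclic))
    fun _ hP _ hF => hF.homExact _ (projective_pA hP)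

theorem Compatible.totallyAcyclic_lB (h : T.Compatible c) {E : HomologicalComplex B c}
    (hE : TotallyAcyclic E) : TotallyAcyclic ((T.lB.mapHomologicalComplex c).obj E) :=
  hE.map T.tB.adj₁ (T.acyclic_lB hE.acyclic) fun _ hP => h.perp_pB hP

theorem Compatible.acyclic_coker (h : T.Compatible c) {E : HomologicalComplex G c}
    (hE : ∀ i, Projective (E.X i)) (hE' : E.Acyclic) :
    ((T.coker.mapHomologicalComplex c).obj E).Acyclic := by
  let S : ShortComplex (HomologicalComplex G c) :=
    { X₁ := ((T.pA ⋙ T.lA).mapHomologicalComplex c).obj E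
      X₂ := E
      X₃ := ((T.coker ⋙ T.lB).mapHomologicalComplex c).obj E
      f := { f := fun i => T.tA.adj₁.counit.app (E.X i)
             comm' := fun i j _ => (T.tA.adj₁.counit.naturality (E.d i j)).symm }
      g := { f := fun i => T.cokerAdj.unit.app (E.X i)
             comm' := fun i j _ => (T.cokerAdj.unit.naturality (E.d i j)).symm }
      zero := by ext i; exact T.lA_lB_hom_eq_zero _ }
  have hS : S.ShortExact := HomologicalComplex.shortExact_of_degreewise_shortExact S fun i =>
    have := hE i
    T.seq_shortExact (E.X i)
  have hA : ((T.pA.mapHomologicalComplex c).obj E).Acyclic := acyclic_map T.pA hE'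
  have h₁ : S.X₁.Acyclic := T.acyclic_lA hA (h.acyclic _ (fun i => projective_pA (hE i)) hA)
  have hq : QuasiIso S.f := ⟨fun i => (quasiIsoAt_iff_exactAt _ i (h₁ i)).2 (hE' i)⟩
  have h₃ : S.X₃.Acyclic := hS.acyclic_X₃ hq
  intro i
  exact (acyclic_map T.pB h₃ i).of_iso ((NatIso.mapHomologicalComplex
    (Functor.isoWhiskerLeft T.coker (asIso T.tB.adj₁.unit).symm) c).app E)

theorem Compatible.totallyAcyclic_coker (h : T.Compatible c) {E : HomologicalComplex G c}
    (hE : TotallyAcyclic E) : TotallyAcyclic ((T.coker.mapHomologicalComplex c).obj E) :=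
  hE.map T.cokerAdj (h.acyclic_coker hE.projective hE.acyclic)
    fun _ hP _ hF => hF.homExact _ (projective_lB hP)

variable (T) in
/-- The sequence `lB (pB N) ⟶ N ⟶ rA (pA N)`, which for modules is
`(0, Y) ⟶ (X, Y) ⟶ (X, 0)`. -/
noncomputable def leftRightSeq (N : G) : ShortComplex G :=
  ShortComplex.mk (T.tB.adj₁.counit.app N) (T.tA.adj₂.unit.app N)
    ((T.tB.adj₁.homEquiv _ _).injective ((T.pB_rA _).eq_of_tgt _ _))

variable (T) in
theorem leftRightSeq_shortExact (N : G) : (T.leftRightSeq N).ShortExact where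
  exact := by
    refine T.exact_of ?_ ?_
    · refine (ShortComplex.exact_iff_mono _ ((T.pA_lB _).eq_of_src _ _)).2 ?_
      exact (inferInstance : Mono (T.pA.map (T.tA.adj₂.unit.app N)))
    · refine (ShortComplex.exact_iff_epi _ ((T.pB_rA _).eq_of_tgt _ _)).2 ?_
      exact (inferInstance : Epi (T.pB.map (T.tB.adj₁.counit.app N)))
  mono_f := T.mono_of _ ((T.pA_lB _).mono _)
    (inferInstance : Mono (T.pB.map (T.tB.adj₁.counit.app N)))
  epi_g := T.epi_of _ (inferInstance : Epi (T.pA.map (T.tA.adj₂.unit.app N)))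
    ((T.pB_rA _).epi _)

/-- By adjunction `Hom(pA E, X)` is `Hom(E, rA X)`, and `rA X` is the quotient of `lA X` by an
object coming from `B`. -/
theorem Compatible.totallyAcyclic_pA (hc : ∀ j, ∃ i, c.Rel i j) (h : T.Compatible c)
    {E : HomologicalComplex G c} (hE : TotallyAcyclic E) :
    TotallyAcyclic ((T.pA.mapHomologicalComplex c).obj E) := by
  refine ⟨fun i => projective_pA (hE.projective i), acyclic_map T.pA hE.acyclic, fun P hP => ?_⟩
  have h₁ : HomExact E (T.lB.obj (T.pB.obj (T.lA.obj P))) :=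
    (homExact_map_iff T.cokerAdj E _).1 (h.perp P hP _ (h.totallyAcyclic_coker hE))
  have h₂ : HomExact E (T.lA.obj P) := hE.homExact _ (projective_lA hP)
  have h₃ := HomExact.of_shortExact_X₃ hc hE.projective (T.leftRightSeq_shortExact _) h₁ h₂
  exact ((homExact_map_iff T.tA.adj₂ E _).2 h₃).of_iso ((asIso T.tA.adj₁.unit).app P).symm

/-- An extension argument for the degreewise split sequence
`lA (pA E) ⟶ E ⟶ lB (c E)`. -/
theorem homExact_of_parts {E : HomologicalComplex G c} (hE : ∀ i, Projective (E.X i)) {N : G}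
    (hA : HomExact ((T.pA.mapHomologicalComplex c).obj E) (T.pA.obj N))
    (hB : HomExact ((T.coker.mapHomologicalComplex c).obj E) (T.pB.obj N)) : HomExact E N := by
  let ε (X : G) : T.lA.obj (T.pA.obj X) ⟶ X := T.tA.adj₁.counit.app X
  let η (X : G) : X ⟶ T.lB.obj (T.coker.obj X) := T.cokerAdj.unit.app X
  have hε {X Y : G} (f : X ⟶ Y) : T.lA.map (T.pA.map f) ≫ ε Y = ε X ≫ f :=
    T.tA.adj₁.counit.naturality f
  have hη {X Y : G} (f : X ⟶ Y) : f ≫ η Y = η X ≫ T.lB.map (T.coker.map f) :=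
    T.cokerAdj.unit.naturality f
  have hS (i : ι) : (ShortComplex.mk (ε (E.X i)) (η (E.X i)) (T.seq _).zero).ShortExact :=
    have := hE i
    T.seq_shortExact (E.X i)
  intro i j k hij hjk f hf
  obtain ⟨g, hg⟩ : ∃ g : T.pA.obj (E.X k) ⟶ T.pA.obj N, T.pA.map (E.d j k) ≫ g = T.pA.map f :=
    hA hij hjk (T.pA.map f) ((T.pA.map_comp _ _).symm.trans (by rw [hf, T.pA.map_zero]; rfl))
  -- The sequence `lA (pA Eᵏ) ⟶ Eᵏ ⟶ lB (c Eᵏ)` splits, hence the adjoint of `g` extends to `Eᵏ`.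
  have : Projective (T.lB.obj (T.coker.obj (E.X k))) := projective_lB (projective_coker (hE k))
  let sp := (hS k).splittingOfProjective
  let r : E.X k ⟶ T.lA.obj (T.pA.obj (E.X k)) := sp.r
  have hr : ε (E.X k) ≫ r = 𝟙 _ := sp.f_r
  let g' : E.X k ⟶ N := r ≫ T.lA.map g ≫ ε N
  have hg' : ε (E.X k) ≫ g' = T.lA.map g ≫ ε N := by
    rw [reassoc_of% hr]
  have h0 : ε (E.X j) ≫ (f - E.d j k ≫ g') = 0 := by
    rw [Preadditive.comp_sub, ← hε f, ← hg, ← Category.assoc, ← hε (E.d j k), Category.assoc, hg',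
      T.lA.map_comp, Category.assoc, sub_self]
  have := (hS j).epi_g
  let h : T.lB.obj (T.coker.obj (E.X j)) ⟶ N := (hS j).exact.desc _ h0
  have hh : η (E.X j) ≫ h = f - E.d j k ≫ g' := (hS j).exact.g_desc _ h0
  obtain ⟨h', hh'⟩ : ∃ h' : T.lB.obj (T.coker.obj (E.X k)) ⟶ N,
      T.lB.map (T.coker.map (E.d j k)) ≫ h' = h := by
    have key : T.lB.map (T.coker.map (E.d i j)) ≫ h = 0 := by
      have : Epi (η (E.X i)) := (hS i).epi_g
      rw [← cancel_epi (η (E.X i)), ← Category.assoc, ← hη, Category.assoc, hh, comp_zero,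
        Preadditive.comp_sub, hf, E.d_comp_d_assoc, zero_comp, sub_zero]
    exact (homExact_map_iff T.tB.adj₁ _ N).2 hB hij hjk h key
  refine ⟨g' + η (E.X k) ≫ h', ?_⟩
  rw [Preadditive.comp_add, ← Category.assoc _ (η _), hη, Category.assoc, hh', hh]
  abel

/-- Exactness of `Hom(E, N)` for all totally acyclic `E` is tested on the two components of `N`. -/
theorem Compatible.totallyAcyclicPerp_iff (hc : ∀ j, ∃ i, c.Rel i j) (h : T.Compatible c) (N : G) :
    totallyAcyclicPerp G c N ↔
      totallyAcyclicPerp A c (T.pA.obj N) ∧ totallyAcyclicPerp B c (T.pB.obj N) := by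
  constructor
  · intro hN
    exact ⟨fun E hE => (homExact_map_iff T.tA.adj₁ E N).1 (hN _ (h.totallyAcyclic_lA hE)),
      fun E hE => (homExact_map_iff T.tB.adj₁ E N).1 (hN _ (h.totallyAcyclic_lB hE))⟩
  · rintro ⟨hA, hB⟩ E hE
    exact homExact_of_parts hE.projective (hA _ (h.totallyAcyclic_pA hc hE))
      (hB _ (h.totallyAcyclic_coker hE))

end Gluing

/-! ### Totally acyclic complexes and Ext -/
section ExtPerp

open Limits Opposite

variable {C : Type*} [Category* C] [Abelian C]

theorem subsingleton_ext_iff_of_projective [HasExt.{w} C] {S : ShortComplex C} (hS : S.ShortExact)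
    [Projective S.X₂] (N : C) :
    Subsingleton (Abelian.Ext.{w} S.X₃ N 1) ↔
      ∀ f : S.X₁ ⟶ N, ∃ g : S.X₂ ⟶ N, S.f ≫ g = f := by
  constructor
  · intro h f
    obtain ⟨g, hg⟩ := Abelian.Ext.contravariant_sequence_exact₁ hS N (Abelian.Ext.mk₀ f)
      (add_zero 1) (Subsingleton.elim _ _)
    obtain ⟨g, rfl⟩ := (Abelian.Ext.mk₀_bijective _ _).2 g
    refine ⟨g, (Abelian.Ext.mk₀_bijective _ _).1 ?_⟩
    rw [← Abelian.Ext.mk₀_comp_mk₀, hg]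
  · intro h
    refine subsingleton_of_forall_eq 0 fun x => ?_
    obtain ⟨f, rfl⟩ := Abelian.Ext.contravariant_sequence_exact₃ hS N x
      (Abelian.Ext.eq_zero_of_projective _) (add_zero 1)
    obtain ⟨f, rfl⟩ := (Abelian.Ext.mk₀_bijective _ _).2 f
    obtain ⟨g, rfl⟩ := h f
    rw [← Abelian.Ext.mk₀_comp_mk₀, ← Abelian.Ext.comp_assoc (a₁₂ := 1) (a₂₃ := 0)
      (h₁₂ := rfl) (h := rfl), hS.extClass_comp, Abelian.Ext.zero_comp]

theorem subsingleton_ext_iff_of_injective [HasExt.{w} C] {S : ShortComplex C} (hS : S.ShortExact)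
    [Injective S.X₂] (N : C) :
    Subsingleton (Abelian.Ext.{w} N S.X₁ 1) ↔
      ∀ f : N ⟶ S.X₃, ∃ g : N ⟶ S.X₂, g ≫ S.g = f := by
  constructor
  · intro h f
    obtain ⟨g, hg⟩ := Abelian.Ext.covariant_sequence_exact₃ N hS (Abelian.Ext.mk₀ f)
      (zero_add 1) (Subsingleton.elim _ _)
    obtain ⟨g, rfl⟩ := (Abelian.Ext.mk₀_bijective _ _).2 g
    refine ⟨g, (Abelian.Ext.mk₀_bijective _ _).1 ?_⟩
    rw [← Abelian.Ext.mk₀_comp_mk₀, hg]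
  · intro h
    refine subsingleton_of_forall_eq 0 fun x => ?_
    obtain ⟨f, rfl⟩ := Abelian.Ext.covariant_sequence_exact₁ N hS x
      (Abelian.Ext.eq_zero_of_injective _) (zero_add 1)
    obtain ⟨f, rfl⟩ := (Abelian.Ext.mk₀_bijective _ _).2 f
    obtain ⟨g, rfl⟩ := h f
    rw [← Abelian.Ext.mk₀_comp_mk₀, Abelian.Ext.comp_assoc (a₁₂ := 0) (a₂₃ := 1)
      (h₂₃ := rfl) (h := rfl), hS.comp_extClass, Abelian.Ext.comp_zero]

theorem subsingleton_ext_of_iso_left [HasExt.{w} C] {X X' Y : C} (e : X ≅ X')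
    (h : Subsingleton (Abelian.Ext.{w} X' Y 1)) : Subsingleton (Abelian.Ext.{w} X Y 1) := by
  refine subsingleton_of_forall_eq 0 fun x => ?_
  have : (Abelian.Ext.mk₀ e.hom).comp ((Abelian.Ext.mk₀ e.inv).comp x (zero_add 1))
      (zero_add 1) = x := by
    simp
  rw [← this, Subsingleton.elim ((Abelian.Ext.mk₀ e.inv).comp x (zero_add 1)) 0,
    Abelian.Ext.comp_zero]

theorem subsingleton_ext_of_iso_right [HasExt.{w} C] {X Y Y' : C} (e : Y ≅ Y')
    (h : Subsingleton (Abelian.Ext.{w} X Y' 1)) : Subsingleton (Abelian.Ext.{w} X Y 1) := by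
  refine subsingleton_of_forall_eq 0 fun x => ?_
  have : (x.comp (Abelian.Ext.mk₀ e.hom) (add_zero 1)).comp (Abelian.Ext.mk₀ e.inv)
      (add_zero 1) = x := by
    simp
  rw [← this, Subsingleton.elim (x.comp (Abelian.Ext.mk₀ e.hom) (add_zero 1)) 0,
    Abelian.Ext.zero_comp]

/-- The sequence `Zⁱ ⟶ Eⁱ ⟶ Zⁱ⁺¹` of an acyclic complex. -/
noncomputable def cyclesSeq (E : CochainComplex C ℤ) (i j : ℤ) : ShortComplex C :=
  ShortComplex.mk (E.iCycles i) (E.toCycles i j) (by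
    rw [← cancel_mono (E.iCycles j), Category.assoc, E.toCycles_i, E.iCycles_d, zero_comp])

theorem epi_toCycles {E : CochainComplex C ℤ} (hE : E.Acyclic) (i j : ℤ) (hij : i + 1 = j) :
    Epi (E.toCycles i j) := by
  have h := (HomologicalComplex.exactAt_iff' E i j (j + 1) (by simp [← hij]) (by simp)).1 (hE j)
  have := h.epi_toCycles
  rw [← E.toCycles_cyclesIsoSc'_hom i j (j + 1) (by simp [← hij]) (by simp)] at this
  exact (epi_comp_iff_of_isIso _ _).1 this

theorem cyclesSeq_shortExact {E : CochainComplex C ℤ} (hE : E.Acyclic) (i j : ℤ) (hij : i + 1 = j) :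
    (cyclesSeq E i j).ShortExact where
  exact := by
    have key {W : C} (g : W ⟶ E.X i) (hg : g ≫ E.toCycles i j = 0) : g ≫ E.d i j = 0 := by
      rw [← E.toCycles_i i j, reassoc_of% hg, zero_comp]
    refine ShortComplex.exact_of_f_is_kernel _ (KernelFork.IsLimit.ofι _ _
      (fun g hg => E.liftCycles g j (by simp [← hij]) (key g hg)) ?_ ?_)
    · intro X g hg
      exact E.liftCycles_i _ _ _ _
    · intro X g hg b hb
      exact (cancel_mono (E.iCycles i)).1 (hb.trans (E.liftCycles_i _ _ _ _).symm)
  mono_f := inferInstanceAs (Mono (E.iCycles i))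
  epi_g := epi_toCycles hE i j hij

theorem isTotallyAcyclicProj_iff (E : CochainComplex C ℤ) :
    IsTotallyAcyclicProj E ↔ TotallyAcyclic E := by
  constructor
  · rintro ⟨h₁, h₂, h₃⟩
    refine ⟨h₁, h₂, fun P hP i j k hij hjk f hf => ?_⟩
    obtain rfl : i = j - 1 := eq_sub_of_add_eq hij
    obtain rfl : j + 1 = k := hjk
    exact (h₃ P hP j f).1 hf
  · rintro ⟨h₁, h₂, h₃⟩
    refine ⟨h₁, h₂, fun P hP i f => ⟨fun hf => ?_, ?_⟩⟩
    · exact h₃ P hP (i := i - 1) (by simp) rfl f hf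
    · rintro ⟨g, rfl⟩
      simp

theorem homExact_op_iff (E : CochainComplex C ℤ) (N : C) :
    HomExact E.op (op N) ↔ ∀ ⦃i j k : ℤ⦄, i + 1 = j → j + 1 = k →
      ∀ f : N ⟶ E.X j, f ≫ E.d j k = 0 → ∃ g : N ⟶ E.X i, g ≫ E.d i j = f := by
  constructor
  · intro h i j k hij hjk f hf
    obtain ⟨g, hg⟩ := h (i := k) (j := j) (k := i) hjk hij f.op (Quiver.Hom.unop_inj hf)
    exact ⟨g.unop, Quiver.Hom.op_inj hg⟩
  · intro h i j k hij hjk f hf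
    obtain ⟨g, hg⟩ := h hjk hij f.unop (Quiver.Hom.op_inj hf)
    exact ⟨g.op, Quiver.Hom.unop_inj hg⟩

/-- Totally acyclic complexes of injectives are totally acyclic complexes of projectives in the
opposite category. -/
theorem isTotallyAcyclicInj_iff (E : CochainComplex C ℤ) :
    IsTotallyAcyclicInj E ↔ TotallyAcyclic E.op := by
  constructor
  · rintro ⟨h₁, h₂, h₃⟩
    refine ⟨fun i => (Injective.injective_iff_projective_op).1 (h₁ i), h₂.op, fun P hP => ?_⟩
    refine (homExact_op_iff E P.unop).2 ?_
    intro i j k hij hjk f hf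
    obtain rfl : i = j - 1 := eq_sub_of_add_eq hij
    obtain rfl : j + 1 = k := hjk
    exact (h₃ P.unop inferInstance j f).1 hf
  · rintro ⟨h₁, h₂, h₃⟩
    refine ⟨fun i => (Injective.injective_iff_projective_op).2 (h₁ i), h₂.unop,
      fun P hP i f => ⟨fun hf => ?_, ?_⟩⟩
    · exact (homExact_op_iff E P).1 (h₃ _ inferInstance) (i := i - 1) (by simp) rfl f hf
    · rintro ⟨g, rfl⟩
      simp

variable {Λ : Type u} [Ring Λ]

/-- The group `Ext¹(Zᵏ⁺¹, N)` measures the failure of maps `Zᵏ ⟶ N` to extend to `Eᵏ`, which is the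
failure of `Hom(E, N)` to be exact. -/
theorem extRightPerp_GProj_iff (N : ModuleCat.{u} Λ) :
    extRightPerp (GProj (ModuleCat.{u} Λ)) N ↔
      totallyAcyclicPerp (ModuleCat.{u} Λ) (ComplexShape.up ℤ) N := by
  constructor
  · intro h E hE i j k hij hjk f hf
    have hS := cyclesSeq_shortExact hE.acyclic k (k + 1) rfl
    have : Projective (cyclesSeq E k (k + 1)).X₂ := hE.projective k
    have := (subsingleton_ext_iff_of_projective hS N).1
      (h _ ⟨E, k + 1, (isTotallyAcyclicProj_iff E).2 hE, ⟨Iso.refl _⟩⟩)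
    have hj := cyclesSeq_shortExact hE.acyclic j k hjk
    have := epi_toCycles hE.acyclic i j hij
    have := hj.epi_g
    have h0 : E.iCycles j ≫ f = 0 := by
      rw [← cancel_epi (E.toCycles i j), E.toCycles_i_assoc, hf, comp_zero]
    let f' : E.cycles k ⟶ N := hj.exact.desc f h0
    have hf' : E.toCycles j k ≫ f' = f := hj.exact.g_desc f h0
    obtain ⟨g, hg⟩ : ∃ g : E.X k ⟶ N, E.iCycles k ≫ g = f' := by tauto
    exact ⟨g, by rw [← E.toCycles_i, Category.assoc, hg, hf']⟩
  · rintro h G ⟨E, l, hE, ⟨e⟩⟩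
    refine subsingleton_ext_of_iso_left e ?_
    obtain ⟨k, rfl⟩ : ∃ k, l = k + 1 := ⟨l - 1, by simp⟩
    have hS := cyclesSeq_shortExact hE.acyclic k (k + 1) rfl
    have : Projective (cyclesSeq E k (k + 1)).X₂ := hE.projective k
    refine (subsingleton_ext_iff_of_projective hS N).2 fun f => ?_
    change E.cycles k ⟶ N at f
    have := epi_toCycles hE.acyclic (k - 1) k (by simp)
    obtain ⟨g, hg⟩ := h E ((isTotallyAcyclicProj_iff E).1 hE) (i := k - 1 - 1) (j := k - 1)
      (k := k) (by simp) (by simp) (E.toCycles (k - 1) k ≫ f) (by simp)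
    refine ⟨g, ?_⟩
    rw [← E.toCycles_i, Category.assoc, cancel_epi] at hg
    exact hg

theorem extLeftPerp_GInj_iff (N : ModuleCat.{u} Λ) :
    extLeftPerp (GInj (ModuleCat.{u} Λ)) N ↔
      totallyAcyclicPerp (ModuleCat.{u} Λ)ᵒᵖ (ComplexShape.up ℤ).symm (op N) := by
  constructor
  · intro h E' hE'
    let E : CochainComplex (ModuleCat.{u} Λ) ℤ := E'.unopSymm
    have hE : IsTotallyAcyclicInj E := (isTotallyAcyclicInj_iff E).2 hE'
    refine (homExact_op_iff E N).2 fun i j k hij hjk f hf => ?_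
    have hS := cyclesSeq_shortExact hE.acyclic i j hij
    have : Injective (cyclesSeq E i j).X₂ := hE.injective i
    obtain ⟨g, hg⟩ := (subsingleton_ext_iff_of_injective hS N).1
      (h _ ⟨E, i, hE, ⟨Iso.refl _⟩⟩) (E.liftCycles f k (by simp [← hjk]) hf)
    change N ⟶ E.X i at g
    change g ≫ E.toCycles i j = _ at hg
    exact ⟨g, by rw [← E.toCycles_i, reassoc_of% hg, E.liftCycles_i]⟩
  · rintro h G ⟨E, i, hE, ⟨e⟩⟩
    refine subsingleton_ext_of_iso_right e ?_
    have hS := cyclesSeq_shortExact hE.acyclic i (i + 1) rfl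
    have : Injective (cyclesSeq E i (i + 1)).X₂ := hE.injective i
    refine (subsingleton_ext_iff_of_injective hS N).2 fun f => ?_
    change N ⟶ E.cycles (i + 1) at f
    obtain ⟨g, hg⟩ := (homExact_op_iff E N).1 (h E.op ((isTotallyAcyclicInj_iff E).1 hE))
      (i := i) (j := i + 1) (k := i + 1 + 1) rfl rfl (f ≫ E.iCycles _) (by simp)
    refine ⟨g, ?_⟩
    rw [← E.toCycles_i, ← Category.assoc, cancel_mono] at hg
    exact hg

end ExtPerp

/-! ### Modules over a triangular matrix ring -/

open scoped TensorProduct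
open MulOpposite

section Corner

variable {A Λ : Type u} [Ring A] [Ring Λ] (f : A →ₙ+* Λ)

/-- The subgroup `e N`, for the idempotent `e = f 1`, as the fixed points of `e`. -/
def corner (N : Type u) [AddCommGroup N] [Module Λ N] : AddSubgroup N where
  carrier := {n | f 1 • n = n}
  zero_mem' := smul_zero _
  add_mem' {a b} ha hb := by
    change f 1 • (a + b) = a + b
    rw [smul_add, ha, hb]
  neg_mem' {a} ha := by
    change f 1 • (-a) = -a
    rw [smul_neg, ha]

variable {N N' : Type u} [AddCommGroup N] [Module Λ N] [AddCommGroup N'] [Module Λ N']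

theorem corner_smul_mem (a : A) (n : N) : f a • n ∈ corner f N := by
  change f 1 • f a • n = f a • n
  rw [smul_smul, ← map_mul, one_mul]

instance : Module A (corner f N) where
  smul a n := ⟨f a • n.1, corner_smul_mem f a n.1⟩
  one_smul n := Subtype.ext n.2
  mul_smul a b n := Subtype.ext (by
    change f (a * b) • n.1 = f a • f b • n.1
    rw [map_mul, mul_smul])
  smul_zero a := Subtype.ext (smul_zero _)
  smul_add a m n := Subtype.ext (smul_add _ _ _)
  add_smul a b n := Subtype.ext (by
    change f (a + b) • n.1 = f a • n.1 + f b • n.1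
    rw [map_add, add_smul])
  zero_smul n := Subtype.ext (by
    change f 0 • n.1 = 0
    rw [map_zero, zero_smul])

/-- The map `e N → e N'` induced by a linear map `N → N'`. -/
def cornerMap (g : N →ₗ[Λ] N') : corner f N →ₗ[A] corner f N' where
  toFun n := ⟨g n.1, (map_smul g _ _).symm.trans (congrArg g n.2)⟩
  map_add' _ _ := Subtype.ext (map_add g _ _)
  map_smul' _ _ := Subtype.ext (map_smul g _ _)

/-- The functor `N ↦ e N`. -/
def cornerFunctor : ModuleCat.{u} Λ ⥤ ModuleCat.{u} A where
  obj N := ModuleCat.of A (corner f N)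
  map g := ModuleCat.ofHom (cornerMap f g.hom)

end Corner

section Glued

variable (R S M : Type u) [Ring R] [Ring S] [AddCommGroup M] [Module S M] [Module Rᵐᵒᵖ M]

/-- A biadditive pairing `M × X → Y` that induces an `S`-linear map `M ⊗_R X → Y`. -/
structure Pairing (X Y : Type u) [AddCommGroup X] [Module R X] [AddCommGroup Y] [Module S Y] where
  /-- the underlying biadditive map -/
  toFun : M →+ X →+ Y
  op_smul : ∀ m (r : R) x, toFun (op r • m) x = toFun m (r • x)
  smul : ∀ (s : S) m x, toFun (s • m) x = s • toFun m x

variable {R S M} {X Y : Type u} [AddCommGroup X] [Module R X] [AddCommGroup Y] [Module S Y]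

/-- The map `M ⊗_R X → Y` induced by a pairing. -/
def Pairing.lift (p : Pairing R S M X Y) : BimodTensor R S M X →ₗ[S] Y :=
  Submodule.liftQ _
    { TensorProduct.liftAddHom p.toFun (fun n m x => by simp) with
      map_smul' := fun s t => by
        induction t with
        | zero => simp
        | add a b ha hb => simp_all
        | tmul m x => simp [TensorProduct.smul_tmul', p.smul] } (by
    refine Submodule.span_le.2 ?_
    rintro _ ⟨m, r, x, rfl⟩
    simp [p.op_smul])

variable (R S M X) in
/-- The universal pairing `M × X → M ⊗_R X`. -/
def tensorPairing : Pairing R S M X (BimodTensor R S M X) where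
  toFun := AddMonoidHom.mk' (fun m => AddMonoidHom.mk'
      (fun x => Submodule.Quotient.mk (m ⊗ₜ[ℤ] x))
      fun x x' => by rw [TensorProduct.tmul_add]; rfl)
    fun m m' => by ext x; simp [TensorProduct.add_tmul]
  op_smul m r x := (Submodule.Quotient.eq _).2 (Submodule.subset_span ⟨m, r, x, rfl⟩)
  smul s m x := rfl

variable (R S M Y) in
/-- The evaluation pairing `M × Hom_S(M, Y) → Y`. -/
def evalPairing [SMulCommClass S Rᵐᵒᵖ M] : Pairing R S M (BimodHom R S M Y) Y where
  toFun := AddMonoidHom.mk' (fun m => AddMonoidHom.mk'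
      (fun f => (show M →ₗ[S] Y from f) m) fun _ _ => rfl)
    fun m m' => by ext f; exact map_add (show M →ₗ[S] Y from f) m m'
  op_smul m r x := rfl
  smul s m f := map_smul (show M →ₗ[S] Y from f) s m

/-- The module `X × Y` over the triangular matrix ring that belongs to a pairing `M × X → Y`. -/
def Glued (_ : Pairing R S M X Y) : Type u := X × Y

instance (p : Pairing R S M X Y) : AddCommGroup (Glued p) := inferInstanceAs (AddCommGroup (X × Y))

variable [SMulCommClass S Rᵐᵒᵖ M]

instance (p : Pairing R S M X Y) : Module (TriMatrix R S M) (Glued p) where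
  smul a z := (a.r • z.1, p.toFun a.m z.1 + a.s • z.2)
  one_smul z := Prod.ext (one_smul R z.1) (by
    change p.toFun 0 z.1 + (1 : S) • z.2 = z.2
    simp)
  mul_smul a b z := Prod.ext (mul_smul a.r b.r z.1) (by
    change p.toFun (op b.r • a.m + a.s • b.m) z.1 + (a.s * b.s) • z.2 =
      p.toFun a.m (b.r • z.1) + a.s • (p.toFun b.m z.1 + b.s • z.2)
    simp [p.op_smul, p.smul, mul_smul, add_assoc])
  smul_zero a := Prod.ext (smul_zero a.r) (by
    change p.toFun a.m 0 + a.s • (0 : Y) = 0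
    simp)
  smul_add a z z' := Prod.ext (smul_add a.r _ _) (by
    change p.toFun a.m (z.1 + z'.1) + a.s • (z.2 + z'.2) =
      (p.toFun a.m z.1 + a.s • z.2) + (p.toFun a.m z'.1 + a.s • z'.2)
    simp only [map_add, smul_add]
    abel)
  add_smul a b z := Prod.ext (add_smul a.r b.r _) (by
    change p.toFun (a.m + b.m) z.1 + (a.s + b.s) • z.2 =
      (p.toFun a.m z.1 + a.s • z.2) + (p.toFun b.m z.1 + b.s • z.2)
    simp only [map_add, add_smul, AddMonoidHom.add_apply]
    abel)
  zero_smul z := Prod.ext (zero_smul R z.1) (by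
    change p.toFun 0 z.1 + (0 : S) • z.2 = 0
    simp)

variable {X' Y' : Type u} [AddCommGroup X'] [Module R X'] [AddCommGroup Y'] [Module S Y']

/-- The linear map `X × Y → X' × Y'` given by compatible maps of the components. -/
def Glued.map {p : Pairing R S M X Y} {p' : Pairing R S M X' Y'} (f : X →ₗ[R] X') (g : Y →ₗ[S] Y')
    (h : ∀ m x, g (p.toFun m x) = p'.toFun m (f x)) :
    Glued p →ₗ[TriMatrix R S M] Glued p' where
  toFun z := (f z.1, g z.2)
  map_add' z z' := Prod.ext (map_add f _ _) (map_add g _ _)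
  map_smul' a z := Prod.ext (map_smul f _ _) (by
    change g (p.toFun a.m z.1 + a.s • z.2) = p'.toFun a.m (f z.1) + a.s • g z.2
    rw [map_add, h, map_smul])

variable (R S M)

/-- The inclusion of `R` as a corner of the triangular matrix ring. -/
def cornerR : R →ₙ+* TriMatrix R S M where
  toFun r := ⟨r, 0, 0⟩
  map_zero' := rfl
  map_add' _ _ := by ext <;> simp
  map_mul' _ _ := by ext <;> simp

variable {R S M} in
@[simp] theorem cornerR_apply (r : R) : cornerR R S M r = ⟨r, 0, 0⟩ := rfl

/-- The inclusion of `S` as a corner of the triangular matrix ring. -/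
def cornerS : S →ₙ+* TriMatrix R S M where
  toFun s := ⟨0, 0, s⟩
  map_zero' := rfl
  map_add' _ _ := by ext <;> simp
  map_mul' _ _ := by ext <;> simp

variable {R S M} in
@[simp] theorem cornerS_apply (s : S) : cornerS R S M s = ⟨0, 0, s⟩ := rfl

/-- The projection of the triangular matrix ring to `R`. -/
def projR : TriMatrix R S M →+* R where
  toFun a := a.r
  map_zero' := rfl
  map_one' := rfl
  map_add' _ _ := rfl
  map_mul' _ _ := rfl

/-- The projection of the triangular matrix ring to `S`. -/
def projS : TriMatrix R S M →+* S where
  toFun a := a.s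
  map_zero' := rfl
  map_one' := rfl
  map_add' _ _ := rfl
  map_mul' _ _ := rfl

end Glued

/-! ### The gluing of modules over a triangular matrix ring -/

section Functors

/-- Restriction of scalars along a surjective ring homomorphism is fully faithful. -/
noncomputable def fullyFaithfulRestrictScalars {Λ A : Type u} [Ring Λ] [Ring A] (f : Λ →+* A)
    (hf : Function.Surjective f) : (ModuleCat.restrictScalars.{u} f).FullyFaithful where
  preimage {X Y} g := ModuleCat.ofHom
    { toFun := fun x => g.hom x
      map_add' := fun x y => map_add g.hom x y
      map_smul' := fun a x => by
        obtain ⟨a, rfl⟩ := hf a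
        exact g.hom.map_smul' a x }

variable (R S M : Type u) [Ring R] [Ring S] [AddCommGroup M] [Module S M] [Module Rᵐᵒᵖ M]
  [SMulCommClass S Rᵐᵒᵖ M]

/-- The functor `X ↦ (X, M ⊗_R X)`. -/
noncomputable def tensorGlue : ModuleCat.{u} R ⥤ ModuleCat.{u} (TriMatrix R S M) where
  obj X := ModuleCat.of _ (Glued (tensorPairing R S M X))
  map f := ModuleCat.ofHom (Glued.map f.hom (tensorMap S M f.hom) fun _ _ => rfl)
  map_id X := by
    ext z
    exact Prod.ext rfl (LinearMap.congr_fun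
      (congrArg ModuleCat.Hom.hom ((tensorFunctor R S M).map_id X)) z.2)
  map_comp f g := by
    ext z
    exact Prod.ext rfl (LinearMap.congr_fun
      (congrArg ModuleCat.Hom.hom ((tensorFunctor R S M).map_comp f g)) z.2)

/-- The functor `Y ↦ (Hom_S(M, Y), Y)`. -/
def homGlue : ModuleCat.{u} S ⥤ ModuleCat.{u} (TriMatrix R S M) where
  obj Y := ModuleCat.of _ (Glued (evalPairing R S M Y))
  map g := ModuleCat.ofHom (Glued.map (homMap R S M g.hom) g.hom fun _ _ => rfl)

variable {R S M} in
/-- The action of the lower left corner on a module over the triangular matrix ring. -/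
def cornerPairing (N : Type u) [AddCommGroup N] [Module (TriMatrix R S M) N] :
    Pairing R S M (corner (cornerR R S M) N) (corner (cornerS R S M) N) where
  toFun := AddMonoidHom.mk' (fun m => AddMonoidHom.mk'
      (fun x => ⟨(⟨0, m, 0⟩ : TriMatrix R S M) • x.1, by
        change (⟨0, 0, 1⟩ : TriMatrix R S M) • (⟨0, m, 0⟩ : TriMatrix R S M) • x.1 = _
        rw [smul_smul]
        congr 1
        ext <;> simp⟩)
      fun x x' => Subtype.ext (smul_add _ _ _))
    fun m m' => by
      ext x
      change (⟨0, m + m', 0⟩ : TriMatrix R S M) • x.1 =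
        (⟨0, m, 0⟩ : TriMatrix R S M) • x.1 + (⟨0, m', 0⟩ : TriMatrix R S M) • x.1
      rw [← add_smul]
      congr 1
      ext <;> simp
  op_smul m r x := Subtype.ext (by
    change (⟨0, op r • m, 0⟩ : TriMatrix R S M) • x.1 =
      (⟨0, m, 0⟩ : TriMatrix R S M) • (⟨r, 0, 0⟩ : TriMatrix R S M) • x.1
    rw [smul_smul]
    congr 1
    ext <;> simp)
  smul s m x := Subtype.ext (by
    change (⟨0, s • m, 0⟩ : TriMatrix R S M) • x.1 =
      (⟨0, 0, s⟩ : TriMatrix R S M) • (⟨0, m, 0⟩ : TriMatrix R S M) • x.1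
    rw [smul_smul]
    congr 1
    ext <;> simp)

section Decomposition

variable {R S M} {N : Type u} [AddCommGroup N] [Module (TriMatrix R S M) N]

theorem corner_decomp (n : N) : cornerR R S M 1 • n + cornerS R S M 1 • n = n := by
  rw [← add_smul]
  conv_rhs => rw [← one_smul (TriMatrix R S M) n]
  congr 1
  ext <;> simp

variable (R S M) in
/-- The first component of an element. -/
def fstPart (n : N) : corner (cornerR R S M) N :=
  ⟨cornerR R S M 1 • n, corner_smul_mem _ _ _⟩

variable (R S M) in
/-- The second component of an element. -/
def sndPart (n : N) : corner (cornerS R S M) N :=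
  ⟨cornerS R S M 1 • n, corner_smul_mem _ _ _⟩

theorem fstPart_smul (a : TriMatrix R S M) (n : N) :
    fstPart R S M (a • n) = a.r • fstPart R S M n := by
  refine Subtype.ext ?_
  change cornerR R S M 1 • a • n = cornerR R S M a.r • cornerR R S M 1 • n
  rw [smul_smul, smul_smul]
  congr 1
  ext <;> simp

theorem sndPart_smul (a : TriMatrix R S M) (n : N) :
    sndPart R S M (a • n) =
      (cornerPairing N).toFun a.m (fstPart R S M n) + a.s • sndPart R S M n := by
  refine Subtype.ext ?_
  change cornerS R S M 1 • a • n = (⟨0, a.m, 0⟩ : TriMatrix R S M) • cornerR R S M 1 • n +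
    cornerS R S M a.s • cornerS R S M 1 • n
  rw [smul_smul, smul_smul, smul_smul, ← add_smul]
  congr 1
  ext <;> simp

theorem smul_coe_fst (a : TriMatrix R S M) (x : corner (cornerR R S M) N) :
    a • x.1 = (a.r • x).1 + ((cornerPairing N).toFun a.m x).1 := by
  change a • x.1 = cornerR R S M a.r • x.1 + (⟨0, a.m, 0⟩ : TriMatrix R S M) • x.1
  have hx : cornerR R S M 1 • x.1 = x.1 := x.2
  rw [← hx, smul_smul, smul_smul, smul_smul, ← add_smul]
  congr 1
  ext <;> simp

theorem smul_coe_snd (a : TriMatrix R S M) (y : corner (cornerS R S M) N) :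
    a • y.1 = (a.s • y).1 := by
  change a • y.1 = cornerS R S M a.s • y.1
  have hy : cornerS R S M 1 • y.1 = y.1 := y.2
  rw [← hy, smul_smul, smul_smul]
  congr 1
  ext <;> simp

variable {X Y : Type u} [AddCommGroup X] [Module R X] [AddCommGroup Y] [Module S Y]

/-- The map `X × Y → N` given by compatible maps to the two corners of `N`. -/
def Glued.desc {p : Pairing R S M X Y} (f : X →ₗ[R] corner (cornerR R S M) N)
    (g : Y →ₗ[S] corner (cornerS R S M) N)
    (h : ∀ m x, g (p.toFun m x) = (cornerPairing N).toFun m (f x)) :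
    Glued p →ₗ[TriMatrix R S M] N where
  toFun z := (f z.1).1 + (g z.2).1
  map_add' z z' := by
    change (f (z.1 + z'.1)).1 + (g (z.2 + z'.2)).1 = _
    rw [map_add, map_add]
    exact add_add_add_comm _ _ _ _
  map_smul' a z := by
    change (f (a.r • z.1)).1 + (g (p.toFun a.m z.1 + a.s • z.2)).1 =
      a • ((f z.1).1 + (g z.2).1)
    rw [smul_add, smul_coe_fst, smul_coe_snd, map_add, map_smul, map_smul, h]
    exact (add_assoc _ _ _).symm

/-- The map `N → X × Y` given by compatible maps from the two corners of `N`. -/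
def Glued.lift {p : Pairing R S M X Y} (f : corner (cornerR R S M) N →ₗ[R] X)
    (g : corner (cornerS R S M) N →ₗ[S] Y)
    (h : ∀ m x, g ((cornerPairing N).toFun m x) = p.toFun m (f x)) :
    N →ₗ[TriMatrix R S M] Glued p where
  toFun n := (f (fstPart R S M n), g (sndPart R S M n))
  map_add' n n' := Prod.ext
    ((congrArg f (Subtype.ext (smul_add _ _ _))).trans (map_add f _ _))
    ((congrArg g (Subtype.ext (smul_add _ _ _))).trans (map_add g _ _))
  map_smul' a n := Prod.ext ((congrArg f (fstPart_smul a n)).trans (map_smul f _ _)) (by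
    change g (sndPart R S M (a • n)) =
      p.toFun a.m (f (fstPart R S M n)) + a.s • g (sndPart R S M n)
    rw [sndPart_smul, map_add, h, map_smul])

/-- The first corner of `X × Y` is `X`. -/
def Glued.fstEquiv (p : Pairing R S M X Y) : corner (cornerR R S M) (Glued p) ≃ₗ[R] X where
  toFun z := z.1.1
  invFun x := ⟨((x, 0) : X × Y), Prod.ext (one_smul R x) (by
    change p.toFun 0 x + (0 : S) • (0 : Y) = 0
    simp)⟩
  map_add' _ _ := rfl
  map_smul' _ _ := rfl
  left_inv z := Subtype.ext (Prod.ext rfl (by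
    have h : p.toFun 0 z.1.1 + (0 : S) • z.1.2 = z.1.2 := congrArg Prod.snd z.2
    simpa using h))
  right_inv _ := rfl

/-- The second corner of `X × Y` is `Y`. -/
def Glued.sndEquiv (p : Pairing R S M X Y) : corner (cornerS R S M) (Glued p) ≃ₗ[S] Y where
  toFun z := z.1.2
  invFun y := ⟨((0, y) : X × Y), Prod.ext (smul_zero _) (by
    change p.toFun 0 0 + (1 : S) • y = y
    simp)⟩
  map_add' _ _ := rfl
  map_smul' s z := by
    change p.toFun 0 z.1.1 + s • z.1.2 = s • z.1.2
    simp
  left_inv z := Subtype.ext (Prod.ext (by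
    have h : (0 : R) • z.1.1 = z.1.1 := congrArg Prod.fst z.2
    simpa using h) rfl)
  right_inv _ := rfl

/-- The map `e_R N → Hom_S(M, e_S N)` adjoint to the action of the lower left corner. -/
def cornerToHom (N : Type u) [AddCommGroup N] [Module (TriMatrix R S M) N] :
    corner (cornerR R S M) N →ₗ[R] BimodHom R S M (corner (cornerS R S M) N) where
  toFun x := (show M →ₗ[S] corner (cornerS R S M) N from
    { toFun := fun m => (cornerPairing N).toFun m x
      map_add' := fun m m' => by simp
      map_smul' := fun s m => (cornerPairing N).smul s m x })
  map_add' x x' := LinearMap.ext fun m => map_add ((cornerPairing N).toFun m) x x'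
  map_smul' r x := LinearMap.ext fun m => ((cornerPairing N).op_smul m r x).symm

end Decomposition

/-- The adjunction between `N ↦ e_R N` and `X ↦ (X, 0)`. -/
noncomputable def cornerRAdj :
    cornerFunctor (cornerR R S M) ⊣ ModuleCat.restrictScalars (projR R S M) where
  unit :=
    { app N := ModuleCat.ofHom (Y := (ModuleCat.restrictScalars (projR R S M)).obj
          ((cornerFunctor (cornerR R S M)).obj N))
        { toFun := fun n => fstPart R S M n
          map_add' := fun n n' => Subtype.ext (smul_add _ _ _)
          map_smul' := fun a n => fstPart_smul a n }
      naturality N N' g := by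
        ext n
        exact Subtype.ext (map_smul g.hom _ _).symm }
  counit :=
    { app X := ModuleCat.ofHom
        { toFun := fun x => x.1
          map_add' := fun _ _ => rfl
          map_smul' := fun _ _ => rfl } }
  left_triangle_components N := by
    ext x
    exact Subtype.ext x.2
  right_triangle_components X := by
    ext x
    exact one_smul R _

/-- The adjunction between `Y ↦ (0, Y)` and `N ↦ e_S N`. -/
noncomputable def cornerSAdj :
    ModuleCat.restrictScalars (projS R S M) ⊣ cornerFunctor (cornerS R S M) where
  unit :=
    { app Y := ModuleCat.ofHom
        { toFun := fun y => ⟨y, one_smul S y⟩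
          map_add' := fun _ _ => rfl
          map_smul' := fun _ _ => rfl } }
  counit :=
    { app N := ModuleCat.ofHom (X := (ModuleCat.restrictScalars (projS R S M)).obj
          ((cornerFunctor (cornerS R S M)).obj N))
        { toFun := fun y : corner (cornerS R S M) N => y.1
          map_add' := fun _ _ => rfl
          map_smul' := fun a y => (smul_coe_snd a y).symm } }

/-- The adjunction between `X ↦ (X, M ⊗_R X)` and `N ↦ e_R N`. -/
noncomputable def tensorGlueAdj : tensorGlue R S M ⊣ cornerFunctor (cornerR R S M) where
  unit :=
    { app X := ModuleCat.ofHom (Glued.fstEquiv (tensorPairing R S M X)).symm.toLinearMap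
      naturality X X' f := by
        ext x
        exact Subtype.ext (Prod.ext rfl (map_zero (tensorMap S M f.hom)).symm) }
  counit :=
    { app N := ModuleCat.ofHom (Glued.desc LinearMap.id (cornerPairing N).lift fun _ _ => rfl)
      naturality N N' g := by
        ext z
        have h : (cornerPairing N').lift ∘ₗ tensorMap S M (cornerMap (cornerR R S M) g.hom) =
            cornerMap (cornerS R S M) g.hom ∘ₗ (cornerPairing N).lift :=
          bimodTensor_hom_ext S M fun m x => Subtype.ext (map_smul g.hom _ _).symm
        exact (congrArg (g.hom z.1.1 + ·)
          (congrArg Subtype.val (LinearMap.congr_fun h z.2))).trans (map_add g.hom _ _).symm }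
  left_triangle_components X := by
    ext z
    have h : (cornerPairing (Glued (tensorPairing R S M X))).lift ∘ₗ
        tensorMap S M (Glued.fstEquiv (tensorPairing R S M X)).symm.toLinearMap =
        (Glued.sndEquiv (tensorPairing R S M X)).symm.toLinearMap :=
      bimodTensor_hom_ext S M fun m x => Subtype.ext (Prod.ext (zero_smul R x) (by
        change (tensorPairing R S M X).toFun m x + (0 : S) • 0 = (tensorPairing R S M X).toFun m x
        simp))
    have h' := congrArg Subtype.val (LinearMap.congr_fun h z.2)
    exact (congrArg (((z.1, 0) : X × BimodTensor R S M X) + ·) h').trans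
      (Prod.ext (add_zero z.1) (zero_add z.2))
  right_triangle_components N := by
    ext x
    refine Subtype.ext ?_
    change x.1 + ((cornerPairing N).lift 0).1 = x.1
    rw [map_zero]
    exact add_zero _

/-- The adjunction between `N ↦ e_S N` and `Y ↦ (Hom_S(M, Y), Y)`. -/
def homGlueAdj : cornerFunctor (cornerS R S M) ⊣ homGlue R S M where
  unit :=
    { app N := ModuleCat.ofHom (Glued.lift (cornerToHom N) LinearMap.id fun _ _ => rfl)
      naturality N N' g := by
        ext n
        refine Prod.ext (LinearMap.ext fun m => Subtype.ext ?_)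
          (Subtype.ext (map_smul g.hom _ _).symm)
        change (⟨0, m, 0⟩ : TriMatrix R S M) • cornerR R S M 1 • g.hom n =
          g.hom ((⟨0, m, 0⟩ : TriMatrix R S M) • cornerR R S M 1 • n)
        rw [map_smul, map_smul] }
  counit :=
    { app Y := ModuleCat.ofHom (Glued.sndEquiv (evalPairing R S M Y)).toLinearMap }
  left_triangle_components N := by
    ext y
    exact Subtype.ext y.2
  right_triangle_components Y := by
    ext z
    refine Prod.ext (LinearMap.ext fun m => ?_) ?_
    · change (evalPairing R S M Y).toFun m ((1 : R) • z.1) +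
        (0 : S) • ((evalPairing R S M Y).toFun 0 z.1 + (0 : S) • z.2) =
          (evalPairing R S M Y).toFun m z.1
      simp
    · change (evalPairing R S M Y).toFun 0 z.1 + (1 : S) • z.2 = z.2
      simp

/-- The category of modules over the triangular matrix ring, glued from modules over `R` and
modules over `S`. -/
noncomputable def moduleGluing :
    Gluing (ModuleCat.{u} R) (ModuleCat.{u} S) (ModuleCat.{u} (TriMatrix R S M)) where
  pA := cornerFunctor (cornerR R S M)
  lA := tensorGlue R S M
  rA := ModuleCat.restrictScalars (projR R S M)
  pB := cornerFunctor (cornerS R S M)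
  lB := ModuleCat.restrictScalars (projS R S M)
  rB := homGlue R S M
  tA := ⟨tensorGlueAdj R S M, cornerRAdj R S M⟩
  tB := ⟨cornerSAdj R S M, homGlueAdj R S M⟩
  ffA := fullyFaithfulRestrictScalars _ fun r => ⟨⟨r, 0, 0⟩, rfl⟩
  ffB := fullyFaithfulRestrictScalars _ fun s => ⟨⟨0, 0, s⟩, rfl⟩
  pA_lB Y := by
    refine ModuleCat.isZero_of_iff_subsingleton.2 (subsingleton_of_forall_eq 0 fun y => ?_)
    exact Subtype.ext (y.2.symm.trans (zero_smul S y.1))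
  pB_rA X := by
    refine ModuleCat.isZero_of_iff_subsingleton.2 (subsingleton_of_forall_eq 0 fun x => ?_)
    exact Subtype.ext (x.2.symm.trans (zero_smul R x.1))
  isZero N hA hB := by
    rw [ModuleCat.isZero_iff_subsingleton] at *
    refine subsingleton_of_forall_eq 0 fun n => ?_
    have h₁ := congrArg Subtype.val (hA.elim (fstPart R S M n) 0)
    have h₂ := congrArg Subtype.val (hB.elim (sndPart R S M n) 0)
    rw [← corner_decomp (R := R) (S := S) (M := M) n]
    exact (congrArg₂ (· + ·) h₁ h₂).trans (add_zero 0)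

/-- The composite `lA ⋙ pB` is `M ⊗_R -`. -/
noncomputable def tensorIso :
    (moduleGluing R S M).lA ⋙ (moduleGluing R S M).pB ≅ tensorFunctor R S M :=
  NatIso.ofComponents fun X => (Glued.sndEquiv (tensorPairing R S M X)).toModuleIso

/-- The composite `rB ⋙ pA` is `Hom_S(M, -)`. -/
noncomputable def homIso :
    (moduleGluing R S M).rB ⋙ (moduleGluing R S M).pA ≅ homFunctor R S M :=
  NatIso.ofComponents fun Y => (Glued.fstEquiv (evalPairing R S M Y)).toModuleIso

variable {R S M} in
/-- For `s : P → R^(P)`, the pairing `M × P → M^(P)` with `(m, p) ↦ (m s(p)_q)_q`. -/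
noncomputable def coordinatePairing {P : Type u} [AddCommGroup P] [Module R P] [DecidableEq P]
    (s : P →ₗ[R] P →₀ R) : Pairing R S M P (DirectSum P fun _ => M) where
  toFun := AddMonoidHom.mk' (fun m => (Finsupp.liftAddHom fun q =>
      AddMonoidHom.mk' (fun r : R => DirectSum.lof S P (fun _ => M) q (op r • m))
        fun r r' => by rw [MulOpposite.op_add, add_smul, map_add]).comp s.toAddMonoidHom)
    fun m m' => by
      ext1 p
      simp only [AddMonoidHom.comp_apply, AddMonoidHom.add_apply, Finsupp.liftAddHom_apply,
        AddMonoidHom.mk'_apply, smul_add, map_add]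
      exact Finsupp.sum_add
  op_smul m r p := by
    simp only [AddMonoidHom.mk'_apply, AddMonoidHom.comp_apply, Finsupp.liftAddHom_apply,
      LinearMap.toAddMonoidHom_coe, map_smul]
    rw [Finsupp.sum_smul_index fun q => by simp]
    simp only [MulOpposite.op_mul, mul_smul]
  smul a m p := by
    simp only [AddMonoidHom.mk'_apply, AddMonoidHom.comp_apply, Finsupp.liftAddHom_apply,
      LinearMap.toAddMonoidHom_coe, Finsupp.smul_sum, ← map_smul, smul_comm a]

/-- For a projective module `P`, the module `M ⊗_R P` is a summand of a direct sum of copies of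
`M`. -/
theorem addClosure_tensor {P : ModuleCat.{u} R} (hP : Projective P) :
    addClosure S M ((tensorFunctor R S M).obj P) := by
  classical
  have : Module.Projective R P := (IsProjective.iff_projective P).2 hP
  obtain ⟨s, hs⟩ := Module.projective_def'.1 this
  let i : BimodTensor R S M P →ₗ[S] DirectSum P fun _ => M := (coordinatePairing s).lift
  let r : (DirectSum P fun _ => M) →ₗ[S] BimodTensor R S M P :=
    DirectSum.toModule S P _ fun q =>
      { toFun := fun m => (tensorPairing R S M P).toFun m q
        map_add' := fun m m' => by rw [map_add]; rfl
        map_smul' := fun a m => (tensorPairing R S M P).smul a m q }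
  have hir : r ∘ₗ i = LinearMap.id := bimodTensor_hom_ext S M fun m p => by
    have hp : (s p).sum (fun q c => c • q) = p := LinearMap.congr_fun hs p
    change r ((s p).sum fun q c => DirectSum.lof S P (fun _ => M) q (op c • m)) =
      (tensorPairing R S M P).toFun m p
    conv_rhs => rw [← hp]
    rw [map_finsuppSum, map_finsuppSum]
    refine Finsupp.sum_congr fun q _ => ?_
    rw [← (tensorPairing R S M P).op_smul]
    exact DirectSum.toModule_lof S q _
  exact ⟨P, ⟨⟨ModuleCat.ofHom i, ModuleCat.ofHom r, ModuleCat.hom_ext hir⟩⟩⟩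

end Functors

/-! ### Virtually Gorenstein rings -/

section VirtuallyGorenstein

open Opposite

theorem virtuallyGorenstein_iff (Λ : Type u) [Ring Λ] : VirtuallyGorenstein Λ ↔
    ∀ N : ModuleCat.{u} Λ, totallyAcyclicPerp (ModuleCat.{u} Λ) (ComplexShape.up ℤ) N ↔
      totallyAcyclicPerp (ModuleCat.{u} Λ)ᵒᵖ (ComplexShape.up ℤ).symm (op N) := by
  simp only [VirtuallyGorenstein, funext_iff, eq_iff_iff, ← extRightPerp_GProj_iff,
    ← extLeftPerp_GInj_iff]

variable {R S M : Type u} [Ring R] [Ring S] [AddCommGroup M] [Module S M] [Module Rᵐᵒᵖ M]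
  [SMulCommClass S Rᵐᵒᵖ M]

theorem compatible_moduleGluing
    (h1 : ∀ E : CochainComplex (ModuleCat.{u} R) ℤ, (∀ i, Projective (E.X i)) → E.Acyclic →
      (((tensorFunctor R S M).mapHomologicalComplex _).obj E).Acyclic)
    (h2 : addClosure S M ≤ extRightPerp (GProj (ModuleCat.{u} S))) :
    (moduleGluing R S M).Compatible (ComplexShape.up ℤ) where
  acyclic E hE hE' i := (h1 E hE hE' i).of_iso
    ((NatIso.mapHomologicalComplex (tensorIso R S M).symm _).app E)
  perp P hP := (totallyAcyclicPerp_congr ((tensorIso R S M).app P)).2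
    ((extRightPerp_GProj_iff _).1 (h2 _ (addClosure_tensor R S M hP)))

theorem compatible_op_moduleGluing
    (h3 : ∀ E : CochainComplex (ModuleCat.{u} S) ℤ, (∀ i, Injective (E.X i)) → E.Acyclic →
      (((homFunctor R S M).mapHomologicalComplex _).obj E).Acyclic)
    (h4 : ∀ I : ModuleCat.{u} S, Injective I →
      extLeftPerp (GInj (ModuleCat.{u} R)) ((homFunctor R S M).obj I)) :
    (moduleGluing R S M).op.Compatible (ComplexShape.up ℤ).symm where
  acyclic E hE hE' i := by
    have h := h3 E.unopSymm
      (fun i => (Injective.injective_iff_projective_op).2 (hE i)) (fun i => (hE' i).unop)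
    exact ((h i).of_iso ((NatIso.mapHomologicalComplex (homIso R S M).symm _).app E.unopSymm)).op
  perp P hP := (totallyAcyclicPerp_congr ((homIso R S M).app P.unop).symm.op).2
    ((extLeftPerp_GInj_iff _).1 (h4 _ (Injective.injective_iff_projective_op.2 hP)))

end VirtuallyGorenstein
end TriGor

theorem proposition3p2 {k : Type v} [CommRing k] [IsArtinianRing k]
    {R S M : Type u} [Ring R] [Ring S] [Algebra k R] [Algebra k S]
    [Module.Finite k R] [Module.Finite k S]
    [AddCommGroup M] [Module S M] [Module Rᵐᵒᵖ M] [SMulCommClass S Rᵐᵒᵖ M]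
    [Module k M] [IsScalarTower k S M] [IsScalarTower k Rᵐᵒᵖ M] [Module.Finite k M]
    (h1 : ∀ E : CochainComplex (ModuleCat.{u} R) ℤ, (∀ i, Projective (E.X i)) → E.Acyclic →
      (((TriGor.tensorFunctor R S M).mapHomologicalComplex _).obj E).Acyclic)
    (h2 : TriGor.addClosure S M ≤ TriGor.extRightPerp (TriGor.GProj (ModuleCat.{u} S)))
    (h3 : ∀ E : CochainComplex (ModuleCat.{u} S) ℤ, (∀ i, Injective (E.X i)) → E.Acyclic →
      (((TriGor.homFunctor R S M).mapHomologicalComplex _).obj E).Acyclic)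
    (h4 : ∀ I : ModuleCat.{u} S, Injective I →
      TriGor.extLeftPerp (TriGor.GInj (ModuleCat.{u} R)) ((TriGor.homFunctor R S M).obj I)) :
    TriGor.VirtuallyGorenstein (TriGor.TriMatrix R S M) ↔
      TriGor.VirtuallyGorenstein R ∧ TriGor.VirtuallyGorenstein S := by
  let T := TriGor.moduleGluing R S M
  have hT := (TriGor.compatible_moduleGluing h1 h2).totallyAcyclicPerp_iff
    fun j => ⟨j - 1, by simp⟩
  have hT' (N) := (TriGor.compatible_op_moduleGluing h3 h4).totallyAcyclicPerp_iff
    (fun j => ⟨j + 1, rfl⟩) (Opposite.op N)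
  simp only [TriGor.virtuallyGorenstein_iff]
  constructor
  · refine fun h => ⟨fun X => ?_, fun Y => ?_⟩
    · -- Test on the module `(X, 0)`.
      let e : T.pA.obj (T.rA.obj X) ≅ X := (asIso T.tA.adj₂.counit).app X
      have hX := h (T.rA.obj X)
      rw [hT, hT'] at hX
      rw [TriGor.totallyAcyclicPerp_congr e.symm, TriGor.totallyAcyclicPerp_congr e.op]
      have h₁ := TriGor.totallyAcyclicPerp_of_isZero (c := ComplexShape.up ℤ) (T.pB_rA X)
      have h₂ := TriGor.totallyAcyclicPerp_of_isZero (c := (ComplexShape.up ℤ).symm)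
        (T.pB_rA X).op
      exact ⟨fun hx => (hX.1 ⟨hx, h₁⟩).2, fun hx => (hX.2 ⟨h₂, hx⟩).1⟩
    · -- Test on the module `(0, Y)`.
      let e : Y ≅ T.pB.obj (T.lB.obj Y) := (asIso T.tB.adj₁.unit).app Y
      have hY := h (T.lB.obj Y)
      rw [hT, hT'] at hY
      rw [TriGor.totallyAcyclicPerp_congr e, TriGor.totallyAcyclicPerp_congr e.symm.op]
      have h₁ := TriGor.totallyAcyclicPerp_of_isZero (c := ComplexShape.up ℤ) (T.pA_lB Y)
      have h₂ := TriGor.totallyAcyclicPerp_of_isZero (c := (ComplexShape.up ℤ).symm)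
        (T.pA_lB Y).op
      exact ⟨fun hy => (hY.1 ⟨h₁, hy⟩).1, fun hy => (hY.2 ⟨hy, h₂⟩).2⟩
  · rintro ⟨hR, hS⟩ N
    rw [hT, hT', hR, hS]
    exact and_comm
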